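/- Let $\mathbb H$ be the quaternions with the Euclidean norm $|\cdot|$, $\mathbb S=\{I\in\mathbb H: I^2=-1\}$, $B(0,r)=\{q\in\mathbb H:|q|<r\}$ and $\mathbb B=B(0,1)$. A function $f:\mathbb B\to\mathbb H$ is slice regular if for every $I\in\mathbb S$ its restriction $f_I$ to $\mathbb B\cap(\mathbb R+\mathbb RI)$ has continuous partial derivatives and satisfies $\frac12\left(\frac{\partial}{\partial x}+I\frac{\partial}{\partial y}\right)f_I(x+yI)=0$; its slice derivative is $f'(x+yI)=\frac12\left(\frac{\partial}{\partial x}-I\frac{\partial}{\partial y}\right)f_I(x+yI)$. Slice regular functions on $\mathbb B$ have unique expansions $f(q)=\sum_{n\ge0}q^na_n$, $g(q)=\sum_{n\ge0} q^nb_n$; put $f*g(q)=\sum_{n\ge0}q^n\sum_{k=0}^na_kb_{n-k}$, $f^c(q)=\sum_{n\ge0}q^n\overline{a_n}$, $f^s=f*f^c$, and $f^{-*}(q)=f^s(q)^{-1}f^c(q)$ where $f^s(q)\ne0$. For $\alpha\in(0,1)$ let $$\mathcal F_\alpha=\{f:\mathbb B\to\mathbb B \mid f \text{ is slice regular},\ f(0)=0,\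 |f'(0)|=\alpha\},$$ and for $f\in\mathcal F_\alpha$ let $$r_\alpha(f)=\sup\{r\in(0,1]: f|_{B(0,r)}\text{ is injective}\},\qquad r(\mathcal F_\alpha)=\inf\{r_\alpha(f): f\in\mathcal F_\alpha\}.$$ Put $R_\alpha(r)=r\,\dfrac{\alpha-r}{1-\alpha r}$. Then for every $\alpha\in(0,1)$: (a) $\displaystyle r(\mathcal F_\alpha)=\frac{\alpha}{1+\sqrt{1-\alpha^2}}$. (b) For each $f\in\mathcal F_\alpha$, $r_\alpha(f)\ge r(\mathcal F_\alpha)$, with equality if and only if $$f(q)=q\,(1-q\alpha e^{-I\theta})^{-*}*(q-\alpha e^{I\theta})\,v\qquad(q\in\mathbb B)\tag{1}$$ for some $I\in\mathbb S$, $\theta\in\mathbb R$ and $v\in\mathbb H$ with $|v|=1$. (c) For each $0<r\le r(\mathcal F_\alpha)$, $$\bigcap_{f\in\mathcal F_\alpha}f\big(B(0,r)\big)=B\big(0,R_\alpha(r)\big).$$ (d) For each $r\in(0,r(\mathcal F_\alpha))$ and $f\in\mathcal F_\alpha$, $B(0,R_\alpha(r))\subset f(B(0,r))$. Moreover, $B(0,R_\alpha(r))$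 is the largest ball centred at $0$ contained in $f(B(0,r))$ if and only if $f$ is of the form (1) for some $I\in\mathbb S$, $\theta\in\mathbb R$ and $v\in\mathbb H$ with $|v|=1$. -/

import Mathlib

noncomputable section

namespace SliceRegular

/-- The sphere of imaginary units of the quaternions. -/
def imUnits : Set (Quaternion ℝ) := {I | I ^ 2 = -1}

/-- The open ball centred at the origin with radius `r`. -/
def B (r : ℝ) : Set (Quaternion ℝ) := Metric.ball 0 r

/-- The parametrisation `x + y i ↦ x + y I` of the slice `ℂ_I` by the complex plane. -/
def slicePt (I : Quaternion ℝ) (z : ℂ) : Quaternion ℝ :=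
  (z.re : Quaternion ℝ) + (z.im : Quaternion ℝ) * I

/-- The partial derivative `∂f_I/∂x` at the point `x + y I`, where `z = x + y i`. -/
def partialX (f : Quaternion ℝ → Quaternion ℝ) (I : Quaternion ℝ) (z : ℂ) : Quaternion ℝ :=
  fderiv ℝ (fun w : ℂ => f (slicePt I w)) z 1

/-- The partial derivative `∂f_I/∂y` at the point `x + y I`, where `z = x + y i`. -/
def partialY (f : Quaternion ℝ → Quaternion ℝ) (I : Quaternion ℝ) (z : ℂ) : Quaternion ℝ :=
  fderiv ℝ (fun w : ℂ => f (slicePt I w)) z Complex.I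

/-- Slice regularity on an open set `Ω`: on each slice `Ω_I` the function has continuous partial
derivatives and satisfies `(1/2) (∂/∂x + I ∂/∂y) f_I = 0`. Only the values on `Ω` matter. -/
def IsSliceRegularOn (f : Quaternion ℝ → Quaternion ℝ) (Ω : Set (Quaternion ℝ)) : Prop :=
  ∀ I ∈ imUnits,
    ContDiffOn ℝ 1 (fun w : ℂ => f (slicePt I w)) (slicePt I ⁻¹' Ω) ∧
    ∀ z ∈ slicePt I ⁻¹' Ω, (1 / 2 : ℝ) • (partialX f I z + I * partialY f I z) = 0

/-- The `I`-derivative `(1/2) (∂/∂x - I ∂/∂y) f_I` at the point `x + y I`, where `z = x + y i`. -/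
def derivI (f : Quaternion ℝ → Quaternion ℝ) (I : Quaternion ℝ) (z : ℂ) : Quaternion ℝ :=
  (1 / 2 : ℝ) • (partialX f I z - I * partialY f I z)

/-- The quaternion `i`. -/
def unitI : Quaternion ℝ := ⟨0, 1, 0, 0⟩

theorem unitI_mem : unitI ∈ imUnits := by
  change unitI ^ 2 = -1
  have h0 : unitI.re = 0 := rfl
  have h1 : Quaternion.normSq unitI = 1 := by
    rw [Quaternion.normSq_def']
    change (0 : ℝ) ^ 2 + 1 ^ 2 + 0 ^ 2 + 0 ^ 2 = 1
    norm_num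
  rw [Quaternion.sq_eq_neg_normSq.2 h0, h1, Quaternion.coe_one]

open Classical in
/-- An imaginary unit `I` with `q ∈ ℂ_I`: the normalised imaginary part of `q`, and (an arbitrary
choice) the quaternion `i` if `q` is real. -/
def dir (q : Quaternion ℝ) : Quaternion ℝ :=
  if q.im = 0 then unitI else ‖q.im‖⁻¹ • q.im

theorem dir_mem (q : Quaternion ℝ) : dir q ∈ imUnits := by
  unfold dir
  split_ifs with h
  · exact unitI_mem
  · have h1 : ‖q.im‖ ≠ 0 := norm_ne_zero_iff.2 h
    have h2 : q.im ^ 2 = -((‖q.im‖ ^ 2 : ℝ) : Quaternion ℝ) := by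
      rw [Quaternion.sq_eq_neg_normSq.2 (Quaternion.re_im q), Quaternion.normSq_eq_norm_mul_self, sq]
    change (‖q.im‖⁻¹ • q.im) ^ 2 = -1
    rw [smul_pow, h2, smul_neg, ← Quaternion.coe_mul_eq_smul, ← Quaternion.coe_mul,
      ← mul_pow, inv_mul_cancel₀ h1]
    simp

theorem slicePt_dir (q : Quaternion ℝ) : slicePt (dir q) ⟨q.re, ‖q.im‖⟩ = q := by
  have h : ((‖q.im‖ : ℝ) : Quaternion ℝ) * dir q = q.im := by
    unfold dir
    split_ifs with h
    · simp [h]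
    · rw [Quaternion.coe_mul_eq_smul, smul_smul, mul_inv_cancel₀ (norm_ne_zero_iff.2 h), one_smul]
  unfold slicePt
  rw [h]
  exact Quaternion.re_add_im q

/-- The slice derivative `f'`, equal to the `I`-derivative at `q = x + y I`. -/
def sliceDeriv (f : Quaternion ℝ → Quaternion ℝ) (q : Quaternion ℝ) : Quaternion ℝ :=
  derivI f (dir q) ⟨q.re, ‖q.im‖⟩

/-- The power series expansion `f(q) = ∑ qⁿ aₙ` on the open unit ball. -/
def HasExpansion (f : Quaternion ℝ → Quaternion ℝ) (a : ℕ → Quaternion ℝ) : Prop :=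
  ∀ q ∈ B 1, HasSum (fun n : ℕ => q ^ n * a n) (f q)

/-- The expansion is unique. -/
theorem HasExpansion.unique {f : Quaternion ℝ → Quaternion ℝ} {a b : ℕ → Quaternion ℝ}
    (ha : HasExpansion f a) (hb : HasExpansion f b) : a = b := by
  have key : ∀ c : ℕ → Quaternion ℝ, HasExpansion f c →
      HasFPowerSeriesAt (fun x : ℝ => f (x : Quaternion ℝ))
        (fun n => ContinuousMultilinearMap.mkPiRing ℝ (Fin n) (c n)) 0 := by
    intro c hc
    refine hasFPowerSeriesAt_iff.2 ?_
    filter_upwards [Metric.ball_mem_nhds (0 : ℝ) one_pos] with x hx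
    have h := hc (x : Quaternion ℝ) (by
      simpa [B, Metric.mem_ball, dist_zero_right] using hx)
    have e : (fun n : ℕ => (x : Quaternion ℝ) ^ n * c n) = fun n : ℕ => x ^ n •
        FormalMultilinearSeries.coeff (𝕜 := ℝ) (E := Quaternion ℝ)
          (fun n => ContinuousMultilinearMap.mkPiRing ℝ (Fin n) (c n)) n := by
      funext n
      rw [← Quaternion.coe_pow, Quaternion.coe_mul_eq_smul]
      simp [FormalMultilinearSeries.coeff]
    rw [e] at h
    rw [zero_add]
    exact h
  have h := (key a ha).eq_formalMultilinearSeries (key b hb)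
  funext n
  have hn := congrArg (fun p => FormalMultilinearSeries.coeff p n) h
  simpa [FormalMultilinearSeries.coeff] using hn

open Classical in
/-- The coefficients of the power series expansion of `f` on the unit ball (zero if there is
none). -/
def coeff (f : Quaternion ℝ → Quaternion ℝ) : ℕ → Quaternion ℝ :=
  if h : ∃ a, HasExpansion f a then h.choose else 0

theorem HasExpansion.coeff_eq {f : Quaternion ℝ → Quaternion ℝ} {a : ℕ → Quaternion ℝ}
    (ha : HasExpansion f a) : coeff f = a := by
  have h : ∃ a, HasExpansion f a := ⟨a, ha⟩
  rw [coeff, dif_pos h]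
  exact h.choose_spec.unique ha

/-- The regular product `f * g (q) = ∑ qⁿ (∑_{k ≤ n} a_k b_{n-k})`. -/
def starMul (f g : Quaternion ℝ → Quaternion ℝ) (q : Quaternion ℝ) : Quaternion ℝ :=
  ∑' n : ℕ, q ^ n * ∑ k ∈ Finset.range (n + 1), coeff f k * coeff g (n - k)

/-- The regular conjugate `f^c(q) = ∑ qⁿ \bar a_n`. -/
def regConj (f : Quaternion ℝ → Quaternion ℝ) (q : Quaternion ℝ) : Quaternion ℝ :=
  ∑' n : ℕ, q ^ n * star (coeff f n)

/-- The symmetrization `f^s = f * f^c`. -/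
def symmetrization (f : Quaternion ℝ → Quaternion ℝ) : Quaternion ℝ → Quaternion ℝ :=
  starMul f (regConj f)

/-- The regular reciprocal `f^{-*}(q) = f^s(q)⁻¹ f^c(q)`. -/
def starInv (f : Quaternion ℝ → Quaternion ℝ) (q : Quaternion ℝ) : Quaternion ℝ :=
  (symmetrization f q)⁻¹ * regConj f q

/-- The family `F_α` of the slice regular self-maps of the unit ball with `f(0) = 0` and
`|f'(0)| = α`. (Functions are total; their values outside the unit ball are irrelevant.) -/
def family (α : ℝ) : Set (Quaternion ℝ → Quaternion ℝ) :=
  {f | Set.MapsTo f (B 1) (B 1) ∧ IsSliceRegularOn f (B 1) ∧ f 0 = 0 ∧ ‖sliceDeriv f 0‖ = α}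

/-- The radius `r_α(f)` of the largest centred ball (inside the unit ball) on which `f` is
injective. -/
def injRadius (f : Quaternion ℝ → Quaternion ℝ) : ℝ :=
  sSup {r : ℝ | 0 < r ∧ r ≤ 1 ∧ Set.InjOn f (B r)}

/-- `r(F_α)`, the infimum of `r_α(f)` over the family. -/
def familyRadius (α : ℝ) : ℝ := sInf (injRadius '' family α)

/-- `f(q) = q (1 - q α e^{-Iθ})^{-*} * (q - α e^{Iθ}) v` on the unit ball, for some imaginary unit
`I`, real `θ` and unit quaternion `v`. -/
def IsExtremal (α : ℝ) (f : Quaternion ℝ → Quaternion ℝ) : Prop :=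
  ∃ I ∈ imUnits, ∃ θ : ℝ, ∃ v : Quaternion ℝ, ‖v‖ = 1 ∧ ∀ q ∈ B 1,
    f q = q * starMul
      (starInv (fun p => 1 - p * ((α : Quaternion ℝ) * NormedSpace.exp (-(θ • I)))))
      (fun p => p - (α : Quaternion ℝ) * NormedSpace.exp (θ • I)) q * v

/-- `R_α(r) = r (α - r) / (1 - α r)`. -/
def coverRadius (α r : ℝ) : ℝ := r * ((α - r) / (1 - α * r))

end SliceRegular

end

/-!
# The radius of injectivity and the covering radius of regular self-maps of the quaternionic ball

A member of the family has the form `f(q) = q g(q)` with `g` regular, `|g| ≤ 1` and `|g(0)| = α`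
(Schwarz lemma). Put `m(t) = (α - t) / (1 - α t)`, so that `R_α(t) = t m(t)`; the function `m` is a
decreasing involution whose fixed point in `(0, 1)` is `ρ = α / (1 + √(1 - α²))`. Everything rests
on three facts.

* **Schwarz–Pick at the origin** (`schwarzPick`): `|g(q)| ≥ m(|q|)`, and equality at one point
  `q ≠ 0` forces `f` to be extremal (`isExtremal_of_norm_le`). On the slice through `q` the function
  `g` is a holomorphic map into a complex space of dimension two. Its component along `g(0)` is a
  scalar function to which the classical lemma applies; if equality holds this component is a
  Möbius transformation, of modulus one on the unit circle, so the orthogonal component vanishes.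
* **Coincidences** (`norm_le_mul_of_eq`): if `f(p) = f(q) = w` with `p ≠ q`, then `|w| ≤ |p| |q|`.
* **Covering** (`B_subset_image`): if `|f| ≥ R` on the sphere of radius `r`, then `f` takes every
  value of norm less than `R` in the ball of radius `r`.

If `f(p) = f(q)` with `p ≠ q` and `p ≠ 0`, the second fact gives `|g(p)| ≤ |q|`. Together with
`|g(p)| ≥ m(|p|)` and `m(ρ) = ρ` this excludes coincidences in the ball of radius `ρ`. If `f` is not
extremal, then `|g| > ρ` on the closed ball of radius `ρ`, hence by compactness on a larger ball,
and `f` is injective on a larger ball. Likewise the third fact covers the ball of radius `R_α(r)`,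
and a larger one if `f` is not extremal. In the other direction an extremal `f` is, up to
rotations, the function `R_α` along some radius (`IsExtremal.exists_radius`), and `R_α` stops being
injective at `ρ`.

The last two facts are proved through the stem function: `f(x + y I) = b(z) + I c(z)` with
`z = x + i y`, where `b + i c` is a holomorphic function of `z` with values in
`ℍ ⊗ ℂ ≅ M₂(ℂ)`. Its determinant `stemDet` is a holomorphic scalar function, the extreme values of
`|b + I c|` over the imaginary units `I` are the singular values of `b + i c`
(`exists_extreme_units`), and `f` takes the value `w` on the sphere `x + y 𝕊` exactly where the
determinant of `b + i c - w` vanishes.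

For the second fact, two linear factors with zeros of norm `|p|` and `|q|` split off from `f - w`
(`exists_linear_factor`). The quotient of the determinants of `F - w` and of `1 - w̄ F`, for
`F = b + i c`, is bounded by one (`normSq_moebius_lt`), equals `|w|²` at the origin and has the four
zeros that come from the two linear factors; the maximum principle gives `|w|² ≤ |p|² |q|²`. For
the third fact, an omitted value `w ≠ 0` would make half the trace of `(F + w) (F - w)⁻¹`
holomorphic on the disc of radius `r`; its real part is nonnegative on the boundary
(`re_mul_conj_nonneg`), while its value at the origin is `-1`.
-/

noncomputable section

namespace SliceRegular

open Metric Set Filter Topology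

open scoped RealInnerProductSpace

/-! ### Slices -/

theorem mul_self_of_mem_imUnits {I : Quaternion ℝ} (hI : I ∈ imUnits) : I * I = -1 := by
  have h : I ^ 2 = -1 := hI
  rwa [sq] at h

theorem norm_of_mem_imUnits {I : Quaternion ℝ} (hI : I ∈ imUnits) : ‖I‖ = 1 := by
  have h : ‖I ^ 2‖ = 1 := by
    have : I ^ 2 = -1 := hI
    rw [this, norm_neg, norm_one]
  rw [norm_pow] at h
  exact (pow_eq_one_iff_of_nonneg (norm_nonneg _) two_ne_zero).1 h

theorem re_of_mem_imUnits {I : Quaternion ℝ} (hI : I ∈ imUnits) : I.re = 0 := by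
  refine Quaternion.sq_eq_neg_normSq.1 ?_
  have h : I ^ 2 = -1 := hI
  rw [h, Quaternion.normSq_eq_norm_mul_self, norm_of_mem_imUnits hI]
  simp

/-- A quaternion of norm one with zero real part is an imaginary unit. -/
theorem mem_imUnits_of_re_of_norm {I : Quaternion ℝ} (h0 : I.re = 0) (h1 : ‖I‖ = 1) :
    I ∈ imUnits := by
  change I ^ 2 = -1
  rw [Quaternion.sq_eq_neg_normSq.2 h0, Quaternion.normSq_eq_norm_mul_self, h1]
  simp

/-- The embedding `x + y i ↦ x + y I` of `ℂ` into the quaternions as a homomorphism of algebras. -/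
def sliceHom (I : Quaternion ℝ) (hI : I ∈ imUnits) : ℂ →ₐ[ℝ] Quaternion ℝ :=
  Complex.lift ⟨I, mul_self_of_mem_imUnits hI⟩

theorem sliceHom_apply {I : Quaternion ℝ} (hI : I ∈ imUnits) (z : ℂ) :
    sliceHom I hI z = slicePt I z := by
  simp only [sliceHom, Complex.lift_apply, Complex.liftAux_apply, slicePt]
  rw [← Quaternion.coe_mul_eq_smul]
  rfl

theorem slicePt_mul {I : Quaternion ℝ} (hI : I ∈ imUnits) (z w : ℂ) :
    slicePt I (z * w) = slicePt I z * slicePt I w := by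
  simp only [← sliceHom_apply hI, map_mul]

theorem slicePt_add {I : Quaternion ℝ} (hI : I ∈ imUnits) (z w : ℂ) :
    slicePt I (z + w) = slicePt I z + slicePt I w := by
  simp only [← sliceHom_apply hI, map_add]

theorem slicePt_sub {I : Quaternion ℝ} (hI : I ∈ imUnits) (z w : ℂ) :
    slicePt I (z - w) = slicePt I z - slicePt I w := by
  simp only [← sliceHom_apply hI, map_sub]

theorem slicePt_pow {I : Quaternion ℝ} (hI : I ∈ imUnits) (z : ℂ) (n : ℕ) :
    slicePt I (z ^ n) = slicePt I z ^ n := by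
  simp only [← sliceHom_apply hI, map_pow]

theorem norm_slicePt {I : Quaternion ℝ} (hI : I ∈ imUnits) (z : ℂ) :
    ‖slicePt I z‖ = ‖z‖ := by
  have h0 := re_of_mem_imUnits hI
  have h1 : Quaternion.normSq I = 1 := by
    rw [Quaternion.normSq_eq_norm_mul_self, norm_of_mem_imUnits hI, one_mul]
  rw [Quaternion.normSq_def', h0] at h1
  rw [← sq_eq_sq₀ (norm_nonneg _) (norm_nonneg _), sq, ← Quaternion.normSq_eq_norm_mul_self,
    Complex.sq_norm, Complex.normSq_apply, Quaternion.normSq_def']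
  simp only [slicePt, Quaternion.re_add, Quaternion.imI_add, Quaternion.imJ_add,
    Quaternion.imK_add, Quaternion.re_coe, Quaternion.imI_coe, Quaternion.imJ_coe,
    Quaternion.imK_coe, Quaternion.coe_mul_eq_smul, Quaternion.re_smul, Quaternion.imI_smul,
    Quaternion.imJ_smul, Quaternion.imK_smul, smul_eq_mul, h0]
  linear_combination z.im ^ 2 * h1

theorem slicePt_conj {I : Quaternion ℝ} (hI : I ∈ imUnits) (z : ℂ) :
    slicePt I (starRingEnd ℂ z) = star (slicePt I z) := by
  have h : star I = -I := by
    rw [Quaternion.star_eq_neg]; exact re_of_mem_imUnits hI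
  simp [slicePt, Quaternion.coe_mul_eq_smul, h]

theorem slicePt_ofReal (I : Quaternion ℝ) (x : ℝ) : slicePt I (x : ℂ) = (x : Quaternion ℝ) := by
  simp [slicePt]

theorem slicePt_zero (I : Quaternion ℝ) : slicePt I 0 = 0 := by
  simp [slicePt]

theorem slicePt_I (I : Quaternion ℝ) : slicePt I Complex.I = I := by
  simp [slicePt]

theorem mem_B {q : Quaternion ℝ} {r : ℝ} : q ∈ B r ↔ ‖q‖ < r := by
  simp [B]

/-- Every quaternion lies on a slice. -/
theorem exists_slicePt (q : Quaternion ℝ) : ∃ I ∈ imUnits, ∃ z : ℂ, slicePt I z = q :=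
  ⟨dir q, dir_mem q, _, slicePt_dir q⟩

theorem preimage_slicePt_B {I : Quaternion ℝ} (hI : I ∈ imUnits) (r : ℝ) :
    slicePt I ⁻¹' B r = ball 0 r := by
  ext z
  simp [mem_B, norm_slicePt hI]

/-! ### Power series expansions -/

/-- Left multiplication by the elements of `ℂ_I` makes the quaternions a complex normed space. The
restriction of a slice regular function to a slice is holomorphic for this structure. -/
@[reducible] def sliceSpace (I : Quaternion ℝ) (hI : I ∈ imUnits) :
    NormedSpace ℂ (Quaternion ℝ) :=
  { Module.compHom (Quaternion ℝ) (sliceHom I hI).toRingHom with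
    norm_smul_le := fun z q => by
      change ‖sliceHom I hI z * q‖ ≤ _
      rw [norm_mul, sliceHom_apply, norm_slicePt hI] }

/-- A power series is determined by the values of its sum at real points. -/
theorem coeff_unique_real {f : ℝ → Quaternion ℝ} {a b : ℕ → Quaternion ℝ}
    (ha : ∀ x : ℝ, |x| < 1 → HasSum (fun n : ℕ => (x : Quaternion ℝ) ^ n * a n) (f x))
    (hb : ∀ x : ℝ, |x| < 1 → HasSum (fun n : ℕ => (x : Quaternion ℝ) ^ n * b n) (f x)) :
    a = b := by
  have key : ∀ c : ℕ → Quaternion ℝ,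
      (∀ x : ℝ, |x| < 1 → HasSum (fun n : ℕ => (x : Quaternion ℝ) ^ n * c n) (f x)) →
      HasFPowerSeriesAt f
        (fun n => ContinuousMultilinearMap.mkPiRing ℝ (Fin n) (c n)) 0 := by
    intro c hc
    refine hasFPowerSeriesAt_iff.2 ?_
    filter_upwards [Metric.ball_mem_nhds (0 : ℝ) one_pos] with x hx
    have h := hc x (by simpa using hx)
    have e : (fun n : ℕ => (x : Quaternion ℝ) ^ n * c n) = fun n : ℕ => x ^ n •
        FormalMultilinearSeries.coeff (𝕜 := ℝ) (E := Quaternion ℝ)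
          (fun n => ContinuousMultilinearMap.mkPiRing ℝ (Fin n) (c n)) n := by
      funext n
      rw [← Quaternion.coe_pow, Quaternion.coe_mul_eq_smul]
      simp [FormalMultilinearSeries.coeff]
    rw [e] at h
    rw [zero_add]
    exact h
  have h := (key a ha).eq_formalMultilinearSeries (key b hb)
  funext n
  have hn := congrArg (fun p => FormalMultilinearSeries.coeff p n) h
  simpa [FormalMultilinearSeries.coeff] using hn

/-- A function that satisfies the Cauchy–Riemann equations on a slice is complex differentiable
there, with complex derivative its real derivative in the direction `1`. -/
theorem hasDerivAt_slice {f : Quaternion ℝ → Quaternion ℝ} {I : Quaternion ℝ} (hI : I ∈ imUnits)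
    (hf : IsSliceRegularOn f (B 1)) {z : ℂ} (hz : z ∈ ball (0 : ℂ) 1) :
    letI := sliceSpace I hI
    HasDerivAt (fun w : ℂ => f (slicePt I w)) (partialX f I z) z := by
  let := sliceSpace I hI
  have : IsScalarTower ℝ ℂ (Quaternion ℝ) := ⟨fun x w q => by
    change sliceHom I hI (x • w) * q = x • (sliceHom I hI w * q)
    rw [map_smul, smul_mul_assoc]⟩
  obtain ⟨h1, h2⟩ := hf I hI
  rw [preimage_slicePt_B hI] at h1 h2
  have hd : HasFDerivAt (fun w : ℂ => f (slicePt I w))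
      (fderiv ℝ (fun w : ℂ => f (slicePt I w)) z) z :=
    ((h1.differentiableOn one_ne_zero).differentiableAt (isOpen_ball.mem_nhds hz)).hasFDerivAt
  have h3 := h2 z hz
  rw [smul_eq_zero_iff_right (by norm_num)] at h3
  have h4 : partialY f I z = I * partialX f I z := by
    have h5 := congrArg (fun t => I * t) h3
    simp only [mul_add, ← mul_assoc, mul_self_of_mem_imUnits hI, mul_zero, neg_mul, one_mul] at h5
    rw [← sub_eq_zero, ← neg_eq_zero, ← h5]; abel
  refine (HasFDerivAt.hasDerivAt
    (f' := ContinuousLinearMap.toSpanSingleton ℂ (partialX f I z)) ?_).congr_deriv ?_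
  · refine hasFDerivAt_of_restrictScalars ℝ hd (ContinuousLinearMap.ext fun w => ?_)
    have hw : w = w.re • (1 : ℂ) + w.im • Complex.I := by simp
    have h5 : fderiv ℝ (fun w : ℂ => f (slicePt I w)) z w =
        w.re • partialX f I z + w.im • partialY f I z := by
      conv_lhs => rw [hw, map_add, map_smul, map_smul]
      rfl
    rw [h5, h4]
    change sliceHom I hI w * partialX f I z = _
    rw [sliceHom_apply, slicePt, add_mul, mul_assoc, Quaternion.coe_mul_eq_smul,
      Quaternion.coe_mul_eq_smul]
  · simp

/-- Slice regular functions on the unit ball have power series expansions, and the slice derivative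
at the origin is the coefficient of degree one. On each slice the expansion is the Taylor series;
the series of two slices have the same coefficients, as they agree on the real axis. -/
theorem IsSliceRegularOn.exists_hasExpansion {f : Quaternion ℝ → Quaternion ℝ}
    (hf : IsSliceRegularOn f (B 1)) :
    ∃ a, HasExpansion f a ∧ sliceDeriv f 0 = a 1 := by
  have key : ∀ I (hI : I ∈ imUnits), ∃ a : ℕ → Quaternion ℝ, partialX f I 0 = a 1 ∧
      ∀ z : ℂ, ‖z‖ < 1 → HasSum (fun n : ℕ => slicePt I z ^ n * a n) (f (slicePt I z)) := by
    intro I hI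
    let := sliceSpace I hI
    have hd : DifferentiableOn ℂ (fun w : ℂ => f (slicePt I w)) (ball 0 1) := fun z hz =>
      (hasDerivAt_slice hI hf hz).differentiableAt.differentiableWithinAt
    refine ⟨fun n => ((n.factorial : ℂ)⁻¹) • iteratedDeriv n (fun w : ℂ => f (slicePt I w)) 0,
      ?_, fun z hz => ?_⟩
    · simp only [Nat.factorial_one, Nat.cast_one, inv_one, iteratedDeriv_one, one_smul]
      exact (hasDerivAt_slice hI hf (by simp)).deriv.symm
    · have h := Complex.hasSum_taylorSeries_on_ball hd (z := z) (by simpa using hz)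
      have e : ∀ n : ℕ, ((n.factorial : ℂ)⁻¹) • (z - 0) ^ n •
          iteratedDeriv n (fun w : ℂ => f (slicePt I w)) 0 = slicePt I z ^ n *
          ((n.factorial : ℂ)⁻¹ • iteratedDeriv n (fun w : ℂ => f (slicePt I w)) 0) := fun n => by
        rw [sub_zero, smul_comm]
        change sliceHom I hI (z ^ n) * _ = _
        rw [map_pow, sliceHom_apply]
      simp only [e] at h
      exact h
  obtain ⟨a, ha1, ha⟩ := key unitI unitI_mem
  refine ⟨a, fun q hq => ?_, ?_⟩
  · obtain ⟨I, hI, z, rfl⟩ := exists_slicePt q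
    obtain ⟨b, -, hb⟩ := key I hI
    have hab : a = b := by
      refine coeff_unique_real (f := fun x => f (x : Quaternion ℝ)) (fun x hx => ?_) fun x hx => ?_
      · simpa only [slicePt_ofReal] using ha (x : ℂ) (by simpa using hx)
      · simpa only [slicePt_ofReal] using hb (x : ℂ) (by simpa using hx)
    rw [hab]
    exact hb z (by simpa [mem_B, norm_slicePt hI] using hq)
  · have him : (0 : Quaternion ℝ).im = 0 := by ext <;> rfl
    have h0 : (⟨(0 : Quaternion ℝ).re, ‖(0 : Quaternion ℝ).im‖⟩ : ℂ) = 0 := by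
      rw [him, norm_zero]; rfl
    have h1 : dir 0 = unitI := by simp [dir, him]
    obtain ⟨-, h2⟩ := hf unitI unitI_mem
    have h3 := h2 0 (by simp [preimage_slicePt_B unitI_mem])
    rw [smul_eq_zero_iff_right (by norm_num)] at h3
    rw [sliceDeriv, h0, h1, derivI, ← ha1, eq_neg_of_add_eq_zero_right h3,
      sub_neg_eq_add, ← two_smul ℝ, smul_smul]
    norm_num

/-- The coefficients `a` define a power series that converges absolutely on the unit ball. -/
def ConvergesOnBall (a : ℕ → Quaternion ℝ) : Prop :=
  ∀ ρ : ℝ, 0 ≤ ρ → ρ < 1 → Summable fun n => ‖a n‖ * ρ ^ n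

theorem HasExpansion.convergesOnBall {f : Quaternion ℝ → Quaternion ℝ} {a : ℕ → Quaternion ℝ}
    (h : HasExpansion f a) : ConvergesOnBall a := by
  intro ρ h0 h1
  have h2 := (h (ρ : Quaternion ℝ) (by
    rw [mem_B, Quaternion.norm_coe, Real.norm_of_nonneg h0]; exact h1)).summable.norm
  refine h2.congr fun n => ?_
  rw [norm_mul, norm_pow, Quaternion.norm_coe, Real.norm_of_nonneg h0, mul_comm]

theorem ConvergesOnBall.summable {a : ℕ → Quaternion ℝ} (h : ConvergesOnBall a)
    {q : Quaternion ℝ} (hq : ‖q‖ < 1) : Summable fun n => q ^ n * a n := by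
  refine Summable.of_norm ((h ‖q‖ (norm_nonneg _) hq).congr fun n => ?_)
  rw [norm_mul, norm_pow, mul_comm]

theorem ConvergesOnBall.hasExpansion {a : ℕ → Quaternion ℝ} (h : ConvergesOnBall a) :
    HasExpansion (fun q => ∑' n, q ^ n * a n) a :=
  fun _ hq => (h.summable (mem_B.1 hq)).hasSum

theorem ConvergesOnBall.sub_const {a : ℕ → Quaternion ℝ} (h : ConvergesOnBall a)
    (w : Quaternion ℝ) : ConvergesOnBall fun n => a n - if n = 0 then w else 0 := by
  have h1 : ∀ q ∈ B 1, HasSum (fun n => q ^ n * (a n - if n = 0 then w else 0))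
      ((∑' n, q ^ n * a n) - w) := by
    intro q hq
    have h2 : HasSum (fun n => q ^ n * if n = 0 then w else 0) w := by
      have h3 := hasSum_ite_eq (α := Quaternion ℝ) 0 w
      refine h3.congr_fun ?_
      intro n
      by_cases hn : n = 0 <;> simp [hn]
    simpa only [mul_sub] using (h.hasExpansion q hq).sub h2
  exact HasExpansion.convergesOnBall (f := fun q => (∑' n, q ^ n * a n) - w) h1

theorem ConvergesOnBall.summable_smul {a : ℕ → Quaternion ℝ} (h : ConvergesOnBall a)
    {z : ℂ} (hz : ‖z‖ < 1) {t : ℕ → ℝ} (ht : ∀ n, |t n| ≤ ‖z ^ n‖) :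
    Summable fun n => t n • a n := by
  refine Summable.of_norm_bounded (h ‖z‖ (norm_nonneg _) hz) fun n => ?_
  rw [norm_smul, mul_comm, Real.norm_eq_abs, ← norm_pow]
  exact mul_le_mul_of_nonneg_left (ht n) (norm_nonneg _)

/-- A power series that converges at each radius below one is continuous on the unit ball. -/
theorem HasExpansion.continuousOn {f : Quaternion ℝ → Quaternion ℝ} {a : ℕ → Quaternion ℝ}
    (h : HasExpansion f a) : ContinuousOn f (B 1) := by
  have h1 : ContinuousOn (fun q => ∑' n, q ^ n * a n) (B 1) := by
    intro q hq
    obtain ⟨ρ, hρ, hρ1⟩ := exists_between (mem_B.1 hq)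
    have h2 : ContinuousOn (fun q => ∑' n, q ^ n * a n) (B ρ) := by
      refine continuousOn_tsum (fun n => by fun_prop)
        (h.convergesOnBall ρ ((norm_nonneg _).trans hρ.le) hρ1) fun n p hp => ?_
      rw [norm_mul, norm_pow, mul_comm]
      have := (mem_B.1 hp).le
      gcongr
    exact (h2.continuousAt (isOpen_ball.mem_nhds (mem_B.2 hρ))).continuousWithinAt
  exact h1.congr fun q hq => (h q hq).tsum_eq.symm

/-! ### The stem function -/

/-- The real part `b` of the stem function `b + i c` of a power series: the value of the series at
`x + y I` is `b + I c` for every imaginary unit `I`. -/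
def stemRe (a : ℕ → Quaternion ℝ) (z : ℂ) : Quaternion ℝ := ∑' n, (z ^ n).re • a n

/-- The imaginary part `c` of the stem function `b + i c` of a power series. -/
def stemIm (a : ℕ → Quaternion ℝ) (z : ℂ) : Quaternion ℝ := ∑' n, (z ^ n).im • a n

/-- The square `⟨b + i c, b + i c⟩` for the complex bilinear extension of the inner product. It is
the determinant of `b + i c` as an element of `ℍ ⊗ ℂ ≅ M₂(ℂ)`. -/
def bilinSq (b c : Quaternion ℝ) : ℂ := ⟨‖b‖ ^ 2 - ‖c‖ ^ 2, 2 * ⟪b, c⟫⟩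

/-- The complex bilinear pairing `⟨w, b + i c⟩` with a quaternion `w`. -/
def bilin (w b c : Quaternion ℝ) : ℂ := ⟨⟪w, b⟫, ⟪w, c⟫⟩

/-- The coordinate of the stem function along the vector `e`. -/
def stemCoord (a : ℕ → Quaternion ℝ) (e : Quaternion ℝ) (z : ℂ) : ℂ :=
  bilin e (stemRe a z) (stemIm a z)

/-- The determinant of the stem function in `ℍ ⊗ ℂ ≅ M₂(ℂ)`; it is the restriction of the
symmetrization to a slice. -/
def stemDet (a : ℕ → Quaternion ℝ) (z : ℂ) : ℂ :=
  bilinSq (stemRe a z) (stemIm a z)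

section Stem

variable {a : ℕ → Quaternion ℝ} {z : ℂ}

theorem hasSum_stemRe (h : ConvergesOnBall a) (hz : ‖z‖ < 1) :
    HasSum (fun n => (z ^ n).re • a n) (stemRe a z) :=
  (h.summable_smul hz fun _ => Complex.abs_re_le_norm _).hasSum

theorem hasSum_stemIm (h : ConvergesOnBall a) (hz : ‖z‖ < 1) :
    HasSum (fun n => (z ^ n).im • a n) (stemIm a z) :=
  (h.summable_smul hz fun _ => Complex.abs_im_le_norm _).hasSum

theorem hasSum_stem {I : Quaternion ℝ} (hI : I ∈ imUnits) (h : ConvergesOnBall a) (hz : ‖z‖ < 1) :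
    HasSum (fun n => slicePt I z ^ n * a n) (stemRe a z + I * stemIm a z) := by
  convert (hasSum_stemRe h hz).add ((hasSum_stemIm h hz).mul_left I) using 2 with n
  rw [← slicePt_pow hI, slicePt, add_mul, Quaternion.coe_mul_eq_smul, Quaternion.coe_mul_eq_smul,
    smul_mul_assoc, mul_smul_comm]

theorem HasExpansion.eq_stem {f : Quaternion ℝ → Quaternion ℝ} {I : Quaternion ℝ}
    (hI : I ∈ imUnits) (h : HasExpansion f a) (hz : ‖z‖ < 1) :
    f (slicePt I z) = stemRe a z + I * stemIm a z :=
  (h _ (by rwa [mem_B, norm_slicePt hI])).unique (hasSum_stem hI h.convergesOnBall hz)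

theorem stemRe_zero (a : ℕ → Quaternion ℝ) : stemRe a 0 = a 0 := by
  rw [stemRe, tsum_eq_single 0]
  · simp
  · intro n hn
    simp [hn]

theorem stemIm_zero (a : ℕ → Quaternion ℝ) : stemIm a 0 = 0 := by
  have e : ∀ n : ℕ, ((0 : ℂ) ^ n).im • a n = 0 := fun n => by
    rcases n with _ | n <;> simp
  simp only [stemIm, e, tsum_zero]

theorem stemDet_zero (a : ℕ → Quaternion ℝ) : stemDet a 0 = ((‖a 0‖ ^ 2 : ℝ) : ℂ) := by
  rw [stemDet, bilinSq, stemRe_zero, stemIm_zero]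
  apply Complex.ext
  · rw [Complex.ofReal_re]; simp
  · rw [Complex.ofReal_im]; simp

theorem stemRe_sub_const (h : ConvergesOnBall a) (hz : ‖z‖ < 1) (w : Quaternion ℝ) :
    stemRe (fun n => a n - if n = 0 then w else 0) z = stemRe a z - w := by
  refine (hasSum_stemRe (h.sub_const w) hz).unique ?_
  have h2 : HasSum (fun n => (z ^ n).re • if n = 0 then w else 0) w := by
    refine (hasSum_ite_eq (α := Quaternion ℝ) 0 w).congr_fun fun n => ?_
    by_cases hn : n = 0 <;> simp [hn]
  simpa only [smul_sub] using (hasSum_stemRe h hz).sub h2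

theorem stemIm_sub_const (a : ℕ → Quaternion ℝ) (z : ℂ) (w : Quaternion ℝ) :
    stemIm (fun n => a n - if n = 0 then w else 0) z = stemIm a z := by
  refine tsum_congr fun n => ?_
  by_cases hn : n = 0 <;> simp [hn]

theorem hasSum_stemCoord (h : ConvergesOnBall a) (hz : ‖z‖ < 1) (e : Quaternion ℝ) :
    HasSum (fun n => z ^ n * (⟪e, a n⟫ : ℝ)) (stemCoord a e z) := by
  rw [Complex.hasSum_iff]
  constructor
  · refine ((innerSL ℝ e).hasSum (hasSum_stemRe h hz)).congr_fun fun n => ?_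
    rw [Complex.re_mul_ofReal, innerSL_apply_apply, inner_smul_right]
  · refine ((innerSL ℝ e).hasSum (hasSum_stemIm h hz)).congr_fun fun n => ?_
    rw [Complex.im_mul_ofReal, innerSL_apply_apply, inner_smul_right]

theorem differentiableOn_stemCoord (h : ConvergesOnBall a) (e : Quaternion ℝ) :
    DifferentiableOn ℂ (stemCoord a e) (ball 0 1) := by
  have h1 : DifferentiableOn ℂ (fun z : ℂ => ∑' n, z ^ n * (⟪e, a n⟫ : ℝ)) (ball 0 1) := by
    intro z hz
    obtain ⟨ρ, hρ, hρ1⟩ := exists_between (mem_ball_zero_iff.1 hz)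
    have h2 : DifferentiableOn ℂ (fun z : ℂ => ∑' n, z ^ n * (⟪e, a n⟫ : ℝ)) (ball 0 ρ) := by
      refine Complex.differentiableOn_tsum_of_summable_norm
        ((h ρ ((norm_nonneg _).trans hρ.le) hρ1).mul_left ‖e‖) (fun n => by fun_prop)
        isOpen_ball fun n w hw => ?_
      rw [norm_mul, norm_pow, Complex.norm_real, mul_comm, ← mul_assoc]
      have := (mem_ball_zero_iff.1 hw).le
      have := norm_inner_le_norm (𝕜 := ℝ) e (a n)
      gcongr
    exact (h2.differentiableAt
      (isOpen_ball.mem_nhds (mem_ball_zero_iff.2 hρ))).differentiableWithinAt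
  exact h1.congr fun z hz => (hasSum_stemCoord h (mem_ball_zero_iff.1 hz) e).tsum_eq.symm

theorem stemDet_eq_sum (a : ℕ → Quaternion ℝ) (z : ℂ) :
    stemDet a z = ∑ i, stemCoord a (stdOrthonormalBasis ℝ (Quaternion ℝ) i) z ^ 2 := by
  have key := (stdOrthonormalBasis ℝ (Quaternion ℝ)).sum_inner_mul_inner
  apply Complex.ext
  · simp only [stemDet, bilinSq, Complex.re_sum, sq, Complex.mul_re, stemCoord, bilin,
      Finset.sum_sub_distrib, ← real_inner_self_eq_norm_mul_norm]
    rw [← key (stemRe a z), ← key (stemIm a z)]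
    simp only [real_inner_comm]
  · simp only [stemDet, bilinSq, Complex.im_sum, sq, Complex.mul_im, stemCoord, bilin,
      Finset.sum_add_distrib]
    rw [← key (stemRe a z), two_mul]
    congr 1 <;> refine Finset.sum_congr rfl fun i _ => ?_
    · rw [real_inner_comm]
    · rw [real_inner_comm, mul_comm]

theorem differentiableOn_stemDet (h : ConvergesOnBall a) :
    DifferentiableOn ℂ (stemDet a) (ball 0 1) := by
  rw [funext (stemDet_eq_sum a)]
  exact DifferentiableOn.fun_sum fun i _ => (differentiableOn_stemCoord h _).pow 2

end Stem

/-! ### Linear factors -/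

/-- A regular power series that vanishes at `p` is the regular product of `q - p` and a regular
power series; this is the relation between the coefficients. The coefficients of the second factor
are the tails `∑ₖ pᵏ a_{n+1+k}`. -/
theorem exists_linear_factor {a : ℕ → Quaternion ℝ} (h : ConvergesOnBall a) {p : Quaternion ℝ}
    (hp : ‖p‖ < 1) (h0 : HasSum (fun n => p ^ n * a n) 0) :
    ∃ b, ConvergesOnBall b ∧ a 0 = -(p * b 0) ∧ ∀ n, a (n + 1) = b n - p * b (n + 1) := by
  have key : ∀ σ : ℝ, ‖p‖ < σ → σ < 1 → ∃ C : ℝ, ∀ n,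
      (Summable fun k => p ^ k * a (n + 1 + k)) ∧
      ‖∑' k, p ^ k * a (n + 1 + k)‖ ≤ C * (σ⁻¹) ^ n := by
    intro σ hσ hσ1
    have hσ0 : 0 < σ := (norm_nonneg p).trans_lt hσ
    have hu : ‖p‖ * σ⁻¹ < 1 := by rwa [← div_eq_mul_inv, div_lt_one hσ0]
    set S := ∑' n, ‖a n‖ * σ ^ n with hS
    have hle : ∀ n, ‖a n‖ ≤ S * (σ⁻¹) ^ n := fun n => by
      rw [inv_pow, ← div_eq_mul_inv, le_div_iff₀ (pow_pos hσ0 n)]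
      exact (h σ hσ0.le hσ1).le_tsum n fun m _ => by positivity
    have hbd : ∀ n k, ‖p ^ k * a (n + 1 + k)‖ ≤ S * (σ⁻¹) ^ (n + 1) * (‖p‖ * σ⁻¹) ^ k := by
      intro n k
      rw [norm_mul, norm_pow, mul_pow]
      calc ‖p‖ ^ k * ‖a (n + 1 + k)‖ ≤ ‖p‖ ^ k * (S * (σ⁻¹) ^ (n + 1 + k)) := by
            gcongr
            exact hle _
        _ = _ := by ring
    have hgeom := hasSum_geometric_of_lt_one (r := ‖p‖ * σ⁻¹) (by positivity) hu
    refine ⟨S * σ⁻¹ * (1 - ‖p‖ * σ⁻¹)⁻¹, fun n => ⟨?_, ?_⟩⟩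
    · exact Summable.of_norm_bounded (hgeom.summable.mul_left _) (hbd n)
    · refine (tsum_of_norm_bounded (hgeom.mul_left _) (hbd n)).trans_eq ?_
      ring
  have hs : ∀ n, Summable fun k => p ^ k * a (n + 1 + k) := by
    obtain ⟨σ, hσ, hσ1⟩ := exists_between hp
    obtain ⟨C, hC⟩ := key σ hσ hσ1
    exact fun n => (hC n).1
  refine ⟨fun n => ∑' k, p ^ k * a (n + 1 + k), ?_, ?_, fun n => ?_⟩
  · intro ρ hρ0 hρ1
    obtain ⟨σ, hσ, hσ1⟩ := exists_between (max_lt hp hρ1)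
    obtain ⟨C, hC⟩ := key σ ((le_max_left _ _).trans_lt hσ) hσ1
    have hσ0 : 0 < σ := hρ0.trans_lt ((le_max_right _ _).trans_lt hσ)
    refine Summable.of_nonneg_of_le (fun n => by positivity) (fun n => ?_)
      ((summable_geometric_of_lt_one (r := ρ / σ) (by positivity)
        ((div_lt_one hσ0).2 ((le_max_right _ _).trans_lt hσ))).mul_left C)
    calc _ ≤ C * (σ⁻¹) ^ n * ρ ^ n := mul_le_mul_of_nonneg_right (hC n).2 (by positivity)
      _ = C * (ρ / σ) ^ n := by rw [mul_assoc, ← mul_pow, div_eq_inv_mul]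
  · have h1 := h0.summable.tsum_eq_zero_add
    rw [h0.tsum_eq] at h1
    simp only [pow_zero, one_mul, pow_succ', mul_assoc] at h1
    rw [tsum_mul_left] at h1
    simp only [zero_add, add_comm 1]
    exact eq_neg_of_add_eq_zero_left h1.symm
  · have h1 := (hs n).tsum_eq_zero_add
    simp only [pow_zero, one_mul, pow_succ', mul_assoc] at h1
    rw [tsum_mul_left] at h1
    have e : ∑' k, p ^ k * a (n + 1 + (k + 1)) = ∑' k, p ^ k * a (n + 1 + 1 + k) :=
      tsum_congr fun k => by rw [show n + 1 + (k + 1) = n + 1 + 1 + k by ring]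
    rw [e, add_zero] at h1
    exact eq_sub_of_add_eq h1.symm

/-- Splitting off the linear factor `q - p` splits off its symmetrization `z² - 2 Re(p) z + |p|²`
from the determinant of the stem function. -/
theorem ConvergesOnBall.stemDet_linear_factor {a b : ℕ → Quaternion ℝ} {p : Quaternion ℝ}
    (hb : ConvergesOnBall b) (h0 : a 0 = -(p * b 0)) (h1 : ∀ n, a (n + 1) = b n - p * b (n + 1))
    {z : ℂ} (hz : ‖z‖ < 1) :
    stemDet a z = (z ^ 2 - 2 * p.re * z + (‖p‖ ^ 2 : ℝ)) * stemDet b z := by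
  have hR := hasSum_stemRe hb hz
  have hI := hasSum_stemIm hb hz
  have eR : stemRe a z = z.re • stemRe b z - z.im • stemIm b z - p * stemRe b z := by
    have h2 := ((hR.const_smul z.re).sub (hI.const_smul z.im)).sub
      (((hasSum_nat_add_iff' 1).2 hR).mul_left p)
    have h3 := (hasSum_nat_add_iff (f := fun n => (z ^ n).re • a n) 1).1 (h2.congr_fun fun n => by
      rw [h1, smul_sub, mul_smul_comm]
      congr 1
      rw [pow_succ', Complex.mul_re, sub_smul, mul_smul, mul_smul])
    rw [stemRe, h3.tsum_eq]
    simp only [Finset.range_one, Finset.sum_singleton, pow_zero, Complex.one_re, one_smul,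
      h0, mul_sub]
    abel
  have eI : stemIm a z = z.re • stemIm b z + z.im • stemRe b z - p * stemIm b z := by
    have h2 := ((hI.const_smul z.re).add (hR.const_smul z.im)).sub
      (((hasSum_nat_add_iff' 1).2 hI).mul_left p)
    have h3 := (hasSum_nat_add_iff (f := fun n => (z ^ n).im • a n) 1).1 (h2.congr_fun fun n => by
      rw [h1, smul_sub, mul_smul_comm]
      congr 1
      rw [pow_succ', Complex.mul_im, add_smul, mul_smul, mul_smul])
    rw [stemIm, h3.tsum_eq]
    simp
  have hn : ∀ q : Quaternion ℝ, ‖q‖ ^ 2 = q.re ^ 2 + q.imI ^ 2 + q.imJ ^ 2 + q.imK ^ 2 := by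
    intro q
    rw [sq, ← Quaternion.normSq_eq_norm_mul_self, Quaternion.normSq_def']
  rw [stemDet, stemDet, bilinSq, bilinSq, eR, eI]
  apply Complex.ext
  · simp [hn, Quaternion.inner_def, -Complex.ofReal_add, -Complex.ofReal_pow, sq]
    ring
  · simp [hn, Quaternion.inner_def, -Complex.ofReal_add, -Complex.ofReal_pow, sq]
    ring

/-! ### Norms on a sphere `x + y 𝕊` -/

theorem norm_add_unit_mul_sq {I : Quaternion ℝ} (hI : I ∈ imUnits) (b c : Quaternion ℝ) :
    ‖b + I * c‖ ^ 2 = ‖b‖ ^ 2 + ‖c‖ ^ 2 + 2 * ⟪b * star c, I⟫ := by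
  rw [norm_add_sq_real, norm_mul, norm_of_mem_imUnits hI, Quaternion.inner_def,
    Quaternion.inner_def, star_mul, mul_assoc]
  ring

theorem inner_dir (p : Quaternion ℝ) : ⟪p, dir p⟫ = ‖p.im‖ := by
  have h0 := re_of_mem_imUnits (dir_mem p)
  have h1 := norm_of_mem_imUnits (dir_mem p)
  conv_lhs => enter [2]; rw [← slicePt_dir p]
  rw [slicePt, inner_add_left, Quaternion.coe_mul_eq_smul, inner_smul_left,
    real_inner_self_eq_norm_sq, h1, Quaternion.inner_def, Quaternion.coe_mul_eq_smul]
  simp [h0]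

theorem neg_mem_imUnits {I : Quaternion ℝ} (hI : I ∈ imUnits) : -I ∈ imUnits := by
  change (-I) ^ 2 = -1
  rw [neg_sq]
  exact hI

/-- The extreme values of `‖b + I c‖²` over the imaginary units `I` are
`‖b‖² + ‖c‖² ± 2 d`, where `d = ‖Im (b c̄)‖`; they are the squared singular values of `b + i c` as
an element of `ℍ ⊗ ℂ ≅ M₂(ℂ)`. -/
theorem exists_extreme_units (b c : Quaternion ℝ) :
    ∃ d : ℝ, 0 ≤ d ∧ d ^ 2 = ‖b‖ ^ 2 * ‖c‖ ^ 2 - ⟪b, c⟫ ^ 2 ∧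
      ∃ I ∈ imUnits, ‖b + I * c‖ ^ 2 = ‖b‖ ^ 2 + ‖c‖ ^ 2 + 2 * d ∧
        ‖b + (-I) * c‖ ^ 2 = ‖b‖ ^ 2 + ‖c‖ ^ 2 - 2 * d := by
  refine ⟨‖(b * star c).im‖, norm_nonneg _, ?_, dir (b * star c), dir_mem _, ?_, ?_⟩
  · have h : ∀ p : Quaternion ℝ, ‖p‖ ^ 2 = p.re ^ 2 + ‖p.im‖ ^ 2 := fun p => by
      simp only [sq, ← Quaternion.normSq_eq_norm_mul_self, Quaternion.normSq_def']
      simp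
      ring
    have h1 := h (b * star c)
    rw [norm_mul, Quaternion.norm_star, mul_pow] at h1
    rw [h1, Quaternion.inner_def]
    ring
  · rw [norm_add_unit_mul_sq (dir_mem _), inner_dir]
  · rw [norm_add_unit_mul_sq (neg_mem_imUnits (dir_mem _)), inner_neg_right, inner_dir]
    ring

theorem normSq_bilinSq {b c : Quaternion ℝ} {d : ℝ}
    (hd : d ^ 2 = ‖b‖ ^ 2 * ‖c‖ ^ 2 - ⟪b, c⟫ ^ 2) :
    Complex.normSq (bilinSq b c) = (‖b‖ ^ 2 + ‖c‖ ^ 2) ^ 2 - 4 * d ^ 2 := by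
  rw [Complex.normSq_apply, bilinSq, hd]
  ring

/-- If the larger singular value `σ₁` of `b + i c` is less than one, then so is the modulus `σ₁ σ₂`
of the determinant, and `σ₁² + σ₂² ≤ 1 + σ₁² σ₂²`. -/
theorem bilinSq_of_forall_norm_lt {b c : Quaternion ℝ} (h : ∀ I ∈ imUnits, ‖b + I * c‖ < 1) :
    2 * (‖b‖ ^ 2 + ‖c‖ ^ 2) ≤ 1 + Complex.normSq (bilinSq b c) ∧
      Complex.normSq (bilinSq b c) < 1 := by
  obtain ⟨d, hd0, hd, I, hI, h1, h2⟩ := exists_extreme_units b c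
  rw [normSq_bilinSq hd]
  have h3 := pow_lt_one₀ (norm_nonneg _) (h I hI) two_ne_zero
  have h4 := sq_nonneg ‖b + -I * c‖
  rw [h1] at h3
  rw [h2] at h4
  constructor <;> nlinarith

/-- If the smaller singular value of `b + i c` is at least `√s`, then `σ₁² σ₂² ≥ s²` and
`s (σ₁² + σ₂²) ≤ s² + σ₁² σ₂²`. -/
theorem bilinSq_of_forall_le_norm {b c : Quaternion ℝ} {s : ℝ} (hs : 0 ≤ s)
    (h : ∀ I ∈ imUnits, s ≤ ‖b + I * c‖ ^ 2) :
    2 * s * (‖b‖ ^ 2 + ‖c‖ ^ 2) ≤ s ^ 2 + Complex.normSq (bilinSq b c) ∧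
      s ^ 2 ≤ Complex.normSq (bilinSq b c) := by
  obtain ⟨d, hd0, hd, I, hI, h1, h2⟩ := exists_extreme_units b c
  rw [normSq_bilinSq hd]
  have h4 := h _ (neg_mem_imUnits hI)
  rw [h2] at h4
  constructor <;> nlinarith

/-- With `A = ⟨F, F⟩`, the vector that is bounded here is the real part of `(Ā - s) F`. Its pairing
with `w` is the only term without a definite sign when the moduli of determinants are compared. -/
theorem norm_bilin_vector_le {b c : Quaternion ℝ} {s : ℝ}
    (h : 2 * s * (‖b‖ ^ 2 + ‖c‖ ^ 2) ≤ s ^ 2 + Complex.normSq (bilinSq b c)) :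
    4 * s * ‖((bilinSq b c).re - s) • b + (bilinSq b c).im • c‖ ^ 2 ≤
      (Complex.normSq (bilinSq b c) - s ^ 2) ^ 2 := by
  rw [Complex.normSq_apply] at *
  rw [norm_add_sq_real, norm_smul, norm_smul, mul_pow, mul_pow, Real.norm_eq_abs, sq_abs,
    Real.norm_eq_abs, sq_abs, inner_smul_left, inner_smul_right]
  have e1 : ‖b‖ ^ 2 = ((‖b‖ ^ 2 + ‖c‖ ^ 2) + (bilinSq b c).re) / 2 := by
    simp only [bilinSq]; ring
  have e2 : ‖c‖ ^ 2 = ((‖b‖ ^ 2 + ‖c‖ ^ 2) - (bilinSq b c).re) / 2 := by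
    simp only [bilinSq]; ring
  have e3 : ⟪b, c⟫ = (bilinSq b c).im / 2 := by
    simp only [bilinSq]; ring
  generalize ‖b‖ ^ 2 + ‖c‖ ^ 2 = n at *
  rw [e1, e2, e3]
  generalize (bilinSq b c).re = u at *
  generalize (bilinSq b c).im = v at *
  have h2 := mul_le_mul_of_nonneg_right h (add_nonneg (sq_nonneg (u - s)) (sq_nonneg v))
  simp only [conj_trivial]
  linarith

/-- The automorphism `X ↦ (X - w) (1 - w̄ X)⁻¹` of the unit ball of `ℍ ⊗ ℂ ≅ M₂(ℂ)` has determinant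
of modulus less than one. -/
theorem normSq_moebius_lt {b c w : Quaternion ℝ} (h : ∀ I ∈ imUnits, ‖b + I * c‖ < 1)
    (hw : ‖w‖ < 1) :
    Complex.normSq (bilinSq b c - 2 * bilin w b c + (‖w‖ ^ 2 : ℝ)) <
      Complex.normSq (1 - 2 * bilin w b c + (‖w‖ ^ 2 : ℝ) * bilinSq b c) := by
  obtain ⟨h1, h2⟩ := bilinSq_of_forall_norm_lt h
  have h3 := norm_bilin_vector_le (s := 1) (by simpa using h1)
  have h4 := abs_le.1 (abs_real_inner_le_norm w
    (((bilinSq b c).re - 1) • b + (bilinSq b c).im • c))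
  rw [inner_add_right, inner_smul_right, inner_smul_right] at h4
  have h5 : 2 * ‖((bilinSq b c).re - 1) • b + (bilinSq b c).im • c‖ ≤
      1 - Complex.normSq (bilinSq b c) := by
    refine abs_le_of_sq_le_sq' ?_ (by linarith) |>.2
    linarith
  generalize ‖((bilinSq b c).re - 1) • b + (bilinSq b c).im • c‖ = y at *
  have hw0 := norm_nonneg w
  have h6 : -((1 - Complex.normSq (bilinSq b c)) * ‖w‖) ≤
      2 * (((bilinSq b c).re - 1) * ⟪w, b⟫ + (bilinSq b c).im * ⟪w, c⟫) := by
    nlinarith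
  have h7 : 0 < (1 - ‖w‖ ^ 2) * ((1 - Complex.normSq (bilinSq b c)) * (1 - ‖w‖) ^ 2) := by
    have : 0 < 1 - ‖w‖ := by linarith
    have : 0 < 1 - ‖w‖ ^ 2 := by nlinarith
    have : 0 < 1 - Complex.normSq (bilinSq b c) := by linarith
    positivity
  have h8 : 0 ≤ 1 - ‖w‖ ^ 2 := by nlinarith
  have h9 := mul_le_mul_of_nonneg_left h6 h8
  have e : Complex.normSq (1 - 2 * bilin w b c + (‖w‖ ^ 2 : ℝ) * bilinSq b c) -
      Complex.normSq (bilinSq b c - 2 * bilin w b c + (‖w‖ ^ 2 : ℝ)) =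
      (1 - ‖w‖ ^ 2) * ((1 + ‖w‖ ^ 2) * (1 - Complex.normSq (bilinSq b c)) +
        4 * (((bilinSq b c).re - 1) * ⟪w, b⟫ + (bilinSq b c).im * ⟪w, c⟫)) := by
    have e1 : (bilin w b c).re = ⟪w, b⟫ := rfl
    have e2 : (bilin w b c).im = ⟪w, c⟫ := rfl
    simp only [Complex.normSq_apply, Complex.add_re, Complex.sub_re, Complex.add_im,
      Complex.sub_im, Complex.ofReal_re,
      Complex.ofReal_im, Complex.one_re, Complex.one_im, ← e1, ← e2, Complex.mul_re,
      Complex.mul_im, Complex.re_ofNat, Complex.im_ofNat]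
    ring
  nlinarith

/-- If `b + i c`, as an element of `ℍ ⊗ ℂ ≅ M₂(ℂ)`, has no singular value below `‖w‖`, then the
trace of `(X + w) (X - w)⁻¹` at `X = b + i c` has nonnegative real part. -/
theorem re_mul_conj_nonneg {b c w : Quaternion ℝ} (h : ∀ I ∈ imUnits, ‖w‖ ≤ ‖b + I * c‖) :
    0 ≤ ((bilinSq b c - (‖w‖ ^ 2 : ℝ)) *
      starRingEnd ℂ (bilinSq b c - 2 * bilin w b c + (‖w‖ ^ 2 : ℝ))).re := by
  obtain ⟨h1, h2⟩ := bilinSq_of_forall_le_norm (s := ‖w‖ ^ 2) (sq_nonneg _) fun I hI => by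
    have := h I hI
    gcongr
  have h3 := norm_bilin_vector_le h1
  have h4 := (abs_le.1 (abs_real_inner_le_norm w
    (((bilinSq b c).re - ‖w‖ ^ 2) • b + (bilinSq b c).im • c))).2
  rw [inner_add_right, inner_smul_right, inner_smul_right] at h4
  have h5 : 2 * (‖w‖ * ‖((bilinSq b c).re - ‖w‖ ^ 2) • b + (bilinSq b c).im • c‖) ≤
      Complex.normSq (bilinSq b c) - (‖w‖ ^ 2) ^ 2 := by
    refine abs_le_of_sq_le_sq' ?_ (by linarith) |>.2
    linarith
  have e : ((bilinSq b c - (‖w‖ ^ 2 : ℝ)) *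
      starRingEnd ℂ (bilinSq b c - 2 * bilin w b c + (‖w‖ ^ 2 : ℝ))).re =
      Complex.normSq (bilinSq b c) - (‖w‖ ^ 2) ^ 2 -
        2 * (((bilinSq b c).re - ‖w‖ ^ 2) * ⟪w, b⟫ + (bilinSq b c).im * ⟪w, c⟫) := by
    have e1 : (bilin w b c).re = ⟪w, b⟫ := rfl
    have e2 : (bilin w b c).im = ⟪w, c⟫ := rfl
    simp only [Complex.normSq_apply, Complex.add_re, Complex.sub_re, Complex.add_im,
      Complex.sub_im, Complex.ofReal_re, Complex.conj_re, Complex.conj_im,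
      Complex.ofReal_im, ← e1, ← e2, Complex.mul_re,
      Complex.mul_im, Complex.re_ofNat, Complex.im_ofNat]
    ring
  linarith

/-! ### Points with a common value -/

section

variable {a : ℕ → Quaternion ℝ} {z : ℂ}

theorem stemDet_sub_const (h : ConvergesOnBall a) (hz : ‖z‖ < 1) (w : Quaternion ℝ) :
    stemDet (fun n => a n - if n = 0 then w else 0) z =
      stemDet a z - 2 * stemCoord a w z + (‖w‖ ^ 2 : ℝ) := by
  rw [stemDet, stemDet, bilinSq, bilinSq, stemCoord, bilin, stemRe_sub_const h hz,
    stemIm_sub_const]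
  apply Complex.ext
  · simp only [Complex.add_re, Complex.sub_re, Complex.mul_re, Complex.ofReal_re,
      Complex.re_ofNat, Complex.im_ofNat, norm_sub_sq_real, real_inner_comm]
    ring
  · simp only [Complex.add_im, Complex.sub_im, Complex.mul_im, Complex.ofReal_im,
      Complex.re_ofNat, Complex.im_ofNat, inner_sub_left]
    ring

theorem differentiableOn_norm_le {φ : ℂ → ℂ} (hφ : DifferentiableOn ℂ φ (ball 0 1)) {ρ C : ℝ}
    (h0 : 0 < ρ) (h1 : ρ < 1) (h : ∀ z : ℂ, ‖z‖ = ρ → ‖φ z‖ ≤ C) {z : ℂ} (hz : ‖z‖ ≤ ρ) :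
    ‖φ z‖ ≤ C := by
  refine Complex.norm_le_of_forall_mem_frontier_norm_le (U := ball 0 ρ) isBounded_ball
    (hφ.diffContOnCl_ball (closedBall_subset_ball h1)) (fun w hw => ?_) ?_
  · rw [frontier_ball _ h0.ne'] at hw
    exact h w (mem_sphere_zero_iff_norm.1 hw)
  · rw [closure_ball _ h0.ne']
    exact mem_closedBall_zero_iff.2 hz

theorem norm_one_sub_conj_mul_le {z ζ : ℂ} {ρ m : ℝ} (hz : ‖z‖ = ρ) (hζ : ‖ζ‖ = m) (hm : m < ρ)
    (hρ : ρ < 1) :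
    ‖1 - starRingEnd ℂ ζ * z‖ * (ρ - m) ≤ (1 - ρ * m) * ‖z - ζ‖ := by
  have hm0 : 0 ≤ m := hζ ▸ norm_nonneg _
  have h1 : 0 ≤ 1 - ρ * m := by nlinarith
  refine abs_le_of_sq_le_sq' ?_ (by positivity) |>.2
  rw [mul_pow, mul_pow, ← Complex.normSq_eq_norm_sq, ← Complex.normSq_eq_norm_sq]
  have hx : z.re * ζ.re + z.im * ζ.im ≤ ρ * m := by
    have h2 := Complex.re_le_norm (z * starRingEnd ℂ ζ)
    rw [norm_mul, Complex.norm_conj, hz, hζ] at h2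
    simpa using h2
  have hz2 : z.re ^ 2 + z.im ^ 2 = ρ ^ 2 := by
    rw [← hz, ← Complex.normSq_eq_norm_sq, Complex.normSq_apply]; ring
  have hζ2 : ζ.re ^ 2 + ζ.im ^ 2 = m ^ 2 := by
    rw [← hζ, ← Complex.normSq_eq_norm_sq, Complex.normSq_apply]; ring
  have e1 : Complex.normSq (1 - starRingEnd ℂ ζ * z) =
      1 - 2 * (z.re * ζ.re + z.im * ζ.im) + ρ ^ 2 * m ^ 2 := by
    rw [← hz2, ← hζ2]; simp [Complex.normSq_apply]; ring
  have e2 : Complex.normSq (z - ζ) = ρ ^ 2 + m ^ 2 - 2 * (z.re * ζ.re + z.im * ζ.im) := by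
    rw [← hz2, ← hζ2]; simp [Complex.normSq_apply]; ring
  rw [e1, e2]
  have h3 : 0 ≤ (ρ * m - (z.re * ζ.re + z.im * ζ.im)) *
      ((1 - ρ) * (1 + m) * ((1 + ρ) * (1 - m))) := by
    have : 0 ≤ ρ * m - (z.re * ζ.re + z.im * ζ.im) := by linarith
    have : 0 ≤ 1 - ρ := by linarith
    have : 0 ≤ 1 - m := by linarith
    have : 0 ≤ 1 + ρ := by linarith
    positivity
  linarith

/-- The quadratic `z² - 2 Re(p) z + |p|²` and its reciprocal polynomial compare on `|z| = ρ` as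
the product of two Blaschke factors does. -/
theorem norm_reciprocal_quadratic_le (p : Quaternion ℝ) {z : ℂ} {ρ : ℝ} (hz : ‖z‖ = ρ)
    (hp : ‖p‖ < ρ) (hρ : ρ < 1) :
    ‖1 - 2 * p.re * z + (‖p‖ ^ 2 : ℝ) * z ^ 2‖ ≤
      ((1 - ρ * ‖p‖) / (ρ - ‖p‖)) ^ 2 * ‖z ^ 2 - 2 * p.re * z + (‖p‖ ^ 2 : ℝ)‖ := by
  set ζ : ℂ := ⟨p.re, ‖p.im‖⟩ with hζ
  have hn : ‖ζ‖ = ‖p‖ := by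
    rw [← norm_slicePt (dir_mem p), slicePt_dir]
  have e0 : ((‖p‖ ^ 2 : ℝ) : ℂ) = starRingEnd ℂ ζ * ζ := by
    rw [← hn, ← Complex.normSq_eq_norm_sq, Complex.normSq_eq_conj_mul_self]
  have e1 : (2 * p.re : ℂ) = ζ + starRingEnd ℂ ζ := by
    rw [Complex.add_conj]; simp [hζ]
  have e2 : 1 - 2 * p.re * z + (‖p‖ ^ 2 : ℝ) * z ^ 2 =
      (1 - starRingEnd ℂ ζ * z) * (1 - starRingEnd ℂ (starRingEnd ℂ ζ) * z) := by
    rw [e0, e1, Complex.conj_conj]; ring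
  have e3 : z ^ 2 - 2 * p.re * z + (‖p‖ ^ 2 : ℝ) = (z - ζ) * (z - starRingEnd ℂ ζ) := by
    rw [e0, e1]; ring
  have h1 := norm_one_sub_conj_mul_le hz hn hp hρ
  have h2 := norm_one_sub_conj_mul_le (ζ := starRingEnd ℂ ζ) hz (by rwa [Complex.norm_conj]) hp hρ
  have h3 : 0 < ρ - ‖p‖ := by linarith
  rw [e2, e3, norm_mul, norm_mul, div_pow, div_mul_eq_mul_div, le_div_iff₀ (by positivity)]
  calc _ = (‖1 - starRingEnd ℂ ζ * z‖ * (ρ - ‖p‖)) *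
        (‖1 - starRingEnd ℂ (starRingEnd ℂ ζ) * z‖ * (ρ - ‖p‖)) := by ring
    _ ≤ ((1 - ρ * ‖p‖) * ‖z - ζ‖) * ((1 - ρ * ‖p‖) * ‖z - starRingEnd ℂ ζ‖) :=
        mul_le_mul h1 h2 (by positivity) (le_trans (by positivity) h1)
    _ = _ := by ring

end

/-- If a regular self-map of the unit ball vanishing at the origin takes the same value at two
distinct points `p` and `q`, then that value has norm at most `‖p‖ ‖q‖`. -/
theorem norm_le_mul_of_eq {f : Quaternion ℝ → Quaternion ℝ} {a : ℕ → Quaternion ℝ}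
    (ha : HasExpansion f a) (h0 : a 0 = 0) (hf : MapsTo f (B 1) (B 1)) {p q : Quaternion ℝ}
    (hp : ‖p‖ < 1) (hq : ‖q‖ < 1) (hne : p ≠ q) (hpq : f p = f q) :
    ‖f p‖ ≤ ‖p‖ * ‖q‖ := by
  have hc := ha.convergesOnBall
  set w := f p with hw
  have hw1 : ‖w‖ < 1 := mem_B.1 (hf (mem_B.2 hp))
  set aw : ℕ → Quaternion ℝ := fun n => a n - if n = 0 then w else 0 with haw
  have hval : ∀ x : Quaternion ℝ, ‖x‖ < 1 → HasSum (fun n => x ^ n * aw n) (f x - w) := by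
    intro x hx
    have h2 : HasSum (fun n => x ^ n * if n = 0 then w else 0) w := by
      refine (hasSum_ite_eq (α := Quaternion ℝ) 0 w).congr_fun fun n => ?_
      by_cases hn : n = 0 <;> simp [hn]
    simpa only [haw, mul_sub] using (ha x (mem_B.2 hx)).sub h2
  -- Split off the zero `p`.
  obtain ⟨b, hb, hb0, hb1⟩ := exists_linear_factor (hc.sub_const w) hp
    (by simpa [hw] using hval p hp)
  -- The remaining factor vanishes at the conjugate `(q - p)⁻¹ q (q - p)` of `q`.
  have hd : q - p ≠ 0 := sub_ne_zero.2 hne.symm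
  set q' := (q - p)⁻¹ * q * (q - p) with hq'
  have hq'n : ‖q'‖ = ‖q‖ := by
    rw [hq', norm_mul, norm_mul, norm_inv]
    have := norm_ne_zero_iff.2 hd
    field_simp
  have hq's : HasSum (fun n => q' ^ n * b n) 0 := by
    have h1 := hval q hq
    rw [hpq, sub_self] at h1
    have hT := (hb.summable (q := q') (hq'n ▸ hq)).hasSum
    have hX := (hb.summable hq).hasSum.mul_left q
    have hconj : SemiconjBy (q - p) q' q := by
      rw [SemiconjBy, hq', ← mul_assoc, ← mul_assoc, mul_inv_cancel₀ hd, one_mul]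
    have h2 : HasSum (fun n => q ^ n * (p * b n)) (q * ∑' n, q ^ n * b n -
        (q - p) * ∑' n, q' ^ n * b n) := by
      refine (hX.sub (hT.mul_left (q - p))).congr_fun fun n => ?_
      rw [← mul_assoc (q - p), (hconj.pow_right n).eq, mul_sub, sub_mul, ← mul_assoc q,
        (Commute.self_pow q n).eq, mul_assoc _ p]
      abel
    have h3 := (hasSum_nat_add_iff (f := fun n => q ^ n * aw n) 1).1
      ((hX.sub ((hasSum_nat_add_iff' 1).2 h2)).congr_fun fun n => by
        rw [show aw (n + 1) = b n - p * b (n + 1) from hb1 n, mul_sub, pow_succ', mul_assoc])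
    have h4 := h3.unique h1
    simp only [Finset.range_one, Finset.sum_singleton, pow_zero, one_mul,
      show aw 0 = -(p * b 0) from hb0] at h4
    have h5 : (q - p) * ∑' n, q' ^ n * b n = 0 := by
      rw [← h4]
      abel
    rw [(mul_eq_zero.1 h5).resolve_left hd] at hT
    exact hT
  obtain ⟨b', hb', hb'0, hb'1⟩ := exists_linear_factor hb (hq'n ▸ hq) hq's
  have hfac : ∀ z : ℂ, ‖z‖ < 1 → stemDet a z - 2 * stemCoord a w z + (‖w‖ ^ 2 : ℝ) =
      (z ^ 2 - 2 * p.re * z + (‖p‖ ^ 2 : ℝ)) * ((z ^ 2 - 2 * q'.re * z + (‖q'‖ ^ 2 : ℝ)) *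
        stemDet b' z) := by
    intro z hz
    rw [← stemDet_sub_const hc hz, hb.stemDet_linear_factor hb0 hb1 hz,
      hb'.stemDet_linear_factor hb'0 hb'1 hz]
  set ε : ℂ → ℂ := fun z => 1 - 2 * stemCoord a w z + (‖w‖ ^ 2 : ℝ) * stemDet a z with hε
  have hlt : ∀ z : ℂ, ‖z‖ < 1 →
      ‖stemDet a z - 2 * stemCoord a w z + (‖w‖ ^ 2 : ℝ)‖ < ‖ε z‖ := by
    intro z hz
    have h1 := normSq_moebius_lt (b := stemRe a z) (c := stemIm a z) (fun I hI => by
      rw [← ha.eq_stem hI hz]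
      exact mem_B.1 (hf (by rwa [mem_B, norm_slicePt hI]))) hw1
    rw [Complex.normSq_eq_norm_sq, Complex.normSq_eq_norm_sq] at h1
    exact lt_of_pow_lt_pow_left₀ 2 (norm_nonneg _) h1
  have hε0 : ∀ z : ℂ, ‖z‖ < 1 → ε z ≠ 0 := fun z hz =>
    norm_pos_iff.1 ((norm_nonneg _).trans_lt (hlt z hz))
  -- The quotient of the two determinants, divided by the Blaschke product of its four zeros.
  set ψ : ℂ → ℂ := fun z => stemDet b' z * (1 - 2 * p.re * z + (‖p‖ ^ 2 : ℝ) * z ^ 2) *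
    (1 - 2 * q'.re * z + (‖q'‖ ^ 2 : ℝ) * z ^ 2) / ε z with hψ
  have hψd : DifferentiableOn ℂ ψ (ball 0 1) := by
    have h1 := differentiableOn_stemDet hb'
    have h2 := differentiableOn_stemDet hc
    have h3 := differentiableOn_stemCoord hc w
    have h4 : DifferentiableOn ℂ ε (ball 0 1) :=
      ((h3.const_mul 2).const_sub 1).add (h2.const_mul _)
    refine DifferentiableOn.div ((h1.mul ?_).mul ?_) h4 fun z hz => hε0 z (mem_ball_zero_iff.1 hz)
    · fun_prop
    · fun_prop
  have hbound : ∀ ρ : ℝ, max ‖p‖ ‖q'‖ < ρ → ρ < 1 → ‖ψ 0‖ ≤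
      ((1 - ρ * ‖p‖) / (ρ - ‖p‖)) ^ 2 * ((1 - ρ * ‖q'‖) / (ρ - ‖q'‖)) ^ 2 := by
    intro ρ hρ hρ1
    obtain ⟨hρp, hρq⟩ := max_lt_iff.1 hρ
    have hρ0 : 0 < ρ := (norm_nonneg _).trans_lt hρp
    refine differentiableOn_norm_le hψd hρ0 hρ1 (fun z hz => ?_) (by simpa using hρ0.le)
    have hz1 : ‖z‖ < 1 := hz ▸ hρ1
    have h1 := norm_reciprocal_quadratic_le p hz hρp hρ1
    have h2 := norm_reciprocal_quadratic_le q' hz hρq hρ1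
    have h3 := (hlt z hz1).le
    rw [hfac z hz1, norm_mul, norm_mul] at h3
    have h4 : 0 < ‖ε z‖ := norm_pos_iff.2 (hε0 z hz1)
    rw [hψ]
    simp only
    rw [norm_div, norm_mul, norm_mul, div_le_iff₀ h4]
    refine le_trans (mul_le_mul (mul_le_mul_of_nonneg_left h1 (norm_nonneg _)) h2
      (norm_nonneg _) (by positivity)) ?_
    refine le_trans (le_of_eq ?_) (mul_le_mul_of_nonneg_left h3 (by positivity))
    ring
  have hlim : Tendsto (fun ρ : ℝ => ((1 - ρ * ‖p‖) / (ρ - ‖p‖)) ^ 2 *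
      ((1 - ρ * ‖q'‖) / (ρ - ‖q'‖)) ^ 2) (𝓝[<] 1) (𝓝 1) := by
    have hq'1 : ‖q'‖ < 1 := hq'n ▸ hq
    have hp' : (1 : ℝ) - ‖p‖ ≠ 0 := by linarith
    have hq'' : (1 : ℝ) - ‖q'‖ ≠ 0 := by linarith
    have hcont : ContinuousAt (fun ρ : ℝ => ((1 - ρ * ‖p‖) / (ρ - ‖p‖)) ^ 2 *
      ((1 - ρ * ‖q'‖) / (ρ - ‖q'‖)) ^ 2) 1 := by
      fun_prop (disch := assumption)
    have := hcont.tendsto.mono_left (nhdsWithin_le_nhds (s := Iio 1))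
    simpa [hp', hq''] using this
  have h1 : ‖ψ 0‖ ≤ 1 := by
    refine ge_of_tendsto hlim ?_
    filter_upwards [Ioo_mem_nhdsLT (max_lt hp (hq'n ▸ hq))] with ρ hρ
    exact hbound ρ hρ.1 hρ.2
  have h2 : ψ 0 = ((‖b' 0‖ ^ 2 : ℝ) : ℂ) := by
    have e : ε 0 = 1 := by
      have e1 : stemCoord a w 0 = 0 := by
        rw [stemCoord, bilin, stemRe_zero, stemIm_zero, h0, inner_zero_right]; rfl
      simp [hε, e1, stemDet_zero, h0]
    simp only [hψ, e, stemDet_zero]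
    simp
  have h3 : ‖b' 0‖ ≤ 1 := by
    rw [h2, Complex.norm_real, Real.norm_of_nonneg (sq_nonneg _)] at h1
    exact (sq_le_one_iff₀ (norm_nonneg _)).1 h1
  have h4 : w = p * -(q' * b' 0) := by
    rw [← hb'0, ← neg_eq_iff_eq_neg.2 hb0]
    simp [h0]
  rw [h4, norm_mul, norm_neg, norm_mul, hq'n, ← mul_assoc]
  exact mul_le_of_le_one_right (by positivity) h3

/-! ### Covering of balls -/

/-- Where the determinant of `b + i c - w` vanishes, `f` takes the value `w` on the sphere
`x + y 𝕊`: the unit `I = -(b - w) c⁻¹` solves `b + I c = w`. -/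
theorem exists_eq_of_stemDet_eq_zero {f : Quaternion ℝ → Quaternion ℝ} {a : ℕ → Quaternion ℝ}
    (ha : HasExpansion f a) {z : ℂ} (hz : ‖z‖ < 1) {w : Quaternion ℝ}
    (h : stemDet a z - 2 * stemCoord a w z + (‖w‖ ^ 2 : ℝ) = 0) :
    ∃ I ∈ imUnits, f (slicePt I z) = w := by
  have hc := ha.convergesOnBall
  rw [← stemDet_sub_const hc hz, stemDet, bilinSq, stemRe_sub_const hc hz,
    stemIm_sub_const] at h
  have h1 := congrArg Complex.re h
  have h2 := congrArg Complex.im h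
  simp only [Complex.zero_re, Complex.zero_im] at h1 h2
  set b := stemRe a z - w with hb
  set c := stemIm a z with hc'
  suffices ∃ I ∈ imUnits, b + I * c = 0 by
    obtain ⟨I, hI, h3⟩ := this
    refine ⟨I, hI, ?_⟩
    rw [ha.eq_stem hI hz, ← hc', ← sub_eq_zero, ← h3, hb]
    abel
  by_cases hc0 : c = 0
  · refine ⟨unitI, unitI_mem, ?_⟩
    rw [hc0] at h1 ⊢
    simpa using h1
  · have hc1 : ‖c‖ ≠ 0 := norm_ne_zero_iff.2 hc0
    refine ⟨-(b * c⁻¹), mem_imUnits_of_re_of_norm ?_ ?_, ?_⟩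
    · have h3 : ⟪b, c⟫ = 0 := by linarith
      rw [Quaternion.inner_def] at h3
      rw [Quaternion.inv_def, mul_smul_comm, Quaternion.re_neg, Quaternion.re_smul, h3]
      simp
    · rw [norm_neg, norm_mul, norm_inv, ← div_eq_mul_inv, div_eq_one_iff_eq hc1]
      exact (sq_eq_sq₀ (norm_nonneg _) (norm_nonneg _)).1 (by linarith)
    · rw [neg_mul, mul_assoc, inv_mul_cancel₀ hc0]
      simp

/-- A regular function vanishing at the origin whose norm is at least `R` on the sphere of radius
`r` takes on the ball of radius `r` every value of norm less than `R`. -/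
theorem B_subset_image {f : Quaternion ℝ → Quaternion ℝ} {a : ℕ → Quaternion ℝ}
    (ha : HasExpansion f a) (h0 : a 0 = 0) {r R : ℝ} (hr0 : 0 < r) (hr1 : r < 1)
    (hR : ∀ q, ‖q‖ = r → R ≤ ‖f q‖) : B R ⊆ f '' B r := by
  intro w hw
  rw [mem_B] at hw
  have hc := ha.convergesOnBall
  by_cases hw0 : w = 0
  · refine ⟨0, by simpa [mem_B] using hr0, ?_⟩
    have h1 := ha.eq_stem unitI_mem (z := 0) (by simp)
    rw [slicePt_zero, stemRe_zero, stemIm_zero, h0] at h1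
    simp [h1, hw0]
  by_contra hcon
  set δ : ℂ → ℂ := fun z => stemDet a z - 2 * stemCoord a w z + (‖w‖ ^ 2 : ℝ) with hδ
  have hδ0 : ∀ z : ℂ, ‖z‖ ≤ r → δ z ≠ 0 := by
    intro z hz hz0
    obtain ⟨I, hI, h1⟩ := exists_eq_of_stemDet_eq_zero ha (hz.trans_lt hr1) hz0
    rcases hz.lt_or_eq with h2 | h2
    · exact hcon ⟨_, by rwa [mem_B, norm_slicePt hI], h1⟩
    · have h3 := hR (slicePt I z) (by rwa [norm_slicePt hI])
      rw [h1] at h3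
      linarith
  have hd1 := differentiableOn_stemDet hc
  have hd2 : DifferentiableOn ℂ δ (ball 0 1) :=
    (hd1.sub ((differentiableOn_stemCoord hc w).const_mul 2)).add_const _
  -- The exponential turns the sign of the real part of the quotient into a bound on the modulus.
  set k : ℂ → ℂ := fun z => Complex.exp (-((stemDet a z - (‖w‖ ^ 2 : ℝ)) / δ z)) with hk
  have hsub : closedBall (0 : ℂ) r ⊆ ball 0 1 := closedBall_subset_ball hr1
  have hkd : DiffContOnCl ℂ k (ball 0 r) := by
    refine ⟨?_, ?_⟩
    · exact (((hd1.sub_const _).mono (ball_subset_closedBall.trans hsub)).div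
        (hd2.mono (ball_subset_closedBall.trans hsub))
        fun z hz => hδ0 z (mem_ball_zero_iff.1 hz).le).neg.cexp
    · rw [closure_ball _ hr0.ne']
      exact (((hd1.sub_const _).continuousOn.mono hsub).div
        (hd2.continuousOn.mono hsub) fun z hz => hδ0 z (mem_closedBall_zero_iff.1 hz)).neg.cexp
  have h1 : ‖k 0‖ ≤ 1 := by
    refine Complex.norm_le_of_forall_mem_frontier_norm_le isBounded_ball hkd (fun z hz => ?_)
      (subset_closure (by simpa using hr0))
    rw [frontier_ball _ hr0.ne', mem_sphere_zero_iff_norm] at hz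
    have h2 := re_mul_conj_nonneg (b := stemRe a z) (c := stemIm a z) (w := w) fun I hI => by
      rw [← ha.eq_stem hI (hz.trans_lt hr1)]
      exact hw.le.trans (hR _ (by rwa [norm_slicePt hI]))
    rw [hk]
    simp only
    rw [Complex.norm_exp, Real.exp_le_one_iff, Complex.neg_re, neg_nonpos, div_eq_mul_inv,
      Complex.inv_def, ← mul_assoc, Complex.re_mul_ofReal]
    exact mul_nonneg h2 (inv_nonneg.2 (Complex.normSq_nonneg _))
  have h2 : k 0 = Complex.exp 1 := by
    have e1 : stemCoord a w 0 = 0 := by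
      rw [stemCoord, bilin, stemRe_zero, stemIm_zero, h0, inner_zero_right]; rfl
    have e2 : ((‖w‖ ^ 2 : ℝ) : ℂ) ≠ 0 := by
      rw [Complex.ofReal_ne_zero]
      exact pow_ne_zero 2 (norm_ne_zero_iff.2 hw0)
    have e3 : stemDet a 0 = 0 := by
      rw [stemDet_zero, h0]; simp
    rw [hk]
    simp only [hδ, e1, e3]
    rw [mul_zero, sub_zero, zero_add, zero_sub, neg_div, neg_neg, div_self e2]
  rw [h2, Complex.norm_exp, Complex.one_re, Real.exp_le_one_iff] at h1
  linarith

/-! ### Extremal functions -/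

theorem HasExpansion.id_mul {f : Quaternion ℝ → Quaternion ℝ} {a : ℕ → Quaternion ℝ}
    (h : HasExpansion f a) :
    HasExpansion (fun q => q * f q) fun n => if n = 0 then 0 else a (n - 1) := by
  intro q hq
  have h1 := (hasSum_nat_add_iff (f := fun n => q ^ n * if n = 0 then 0 else a (n - 1)) 1).1
    (((h q hq).mul_left q).congr_fun fun n => by simp [pow_succ', mul_assoc])
  simpa using h1

theorem HasExpansion.mul_const {f : Quaternion ℝ → Quaternion ℝ} {a : ℕ → Quaternion ℝ}
    (h : HasExpansion f a) (v : Quaternion ℝ) : HasExpansion (fun q => f q * v) fun n => a n * v :=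
  fun q hq => by simpa only [mul_assoc] using (h q hq).mul_right v

theorem HasExpansion.sub {f g : Quaternion ℝ → Quaternion ℝ} {a b : ℕ → Quaternion ℝ}
    (hf : HasExpansion f a) (hg : HasExpansion g b) :
    HasExpansion (fun q => f q - g q) fun n => a n - b n :=
  fun q hq => by simpa only [mul_sub] using (hf q hq).sub (hg q hq)

/-- Two functions with power series expansions that agree at real points agree on the ball. -/
theorem HasExpansion.eqOn_of_real {f g : Quaternion ℝ → Quaternion ℝ} {a b : ℕ → Quaternion ℝ}
    (hf : HasExpansion f a) (hg : HasExpansion g b)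
    (h : ∀ x : ℝ, |x| < 1 → f (x : Quaternion ℝ) = g (x : Quaternion ℝ)) : EqOn f g (B 1) := by
  have hx : ∀ x : ℝ, |x| < 1 → (x : Quaternion ℝ) ∈ B 1 := fun x hx => by
    rwa [mem_B, Quaternion.norm_coe]
  have hab : a = b := coeff_unique_real (f := fun x => f (x : Quaternion ℝ))
    (fun x h1 => hf _ (hx x h1)) fun x h1 => by
      rw [h x h1]
      exact hg _ (hx x h1)
  intro q hq
  have h1 := hf q hq
  rw [hab] at h1
  exact h1.unique (hg q hq)

/-- The regular reciprocal `(1 - q c)^{-*}`, as the geometric series `∑ qⁿ cⁿ`. -/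
def regGeom (c q : Quaternion ℝ) : Quaternion ℝ := ∑' n : ℕ, q ^ n * c ^ n

theorem hasExpansion_regGeom {c : Quaternion ℝ} (hc : ‖c‖ < 1) :
    HasExpansion (regGeom c) fun n => c ^ n := by
  refine ConvergesOnBall.hasExpansion fun ρ h0 h1 => ?_
  have h2 : ‖c‖ * ρ < 1 := by nlinarith [norm_nonneg c]
  refine (summable_geometric_of_lt_one (by positivity) h2).congr fun n => ?_
  rw [mul_pow, norm_pow]

theorem regGeom_eq {c : Quaternion ℝ} (hc : ‖c‖ < 1) {q : Quaternion ℝ} (hq : q ∈ B 1) :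
    regGeom c q = 1 + q * regGeom c q * c := by
  have h1 := hasExpansion_regGeom hc q hq
  have h2 := (hasSum_nat_add_iff (f := fun n => q ^ n * c ^ n) 1).1
    (((h1.mul_left q).mul_right c).congr_fun fun n => by
      rw [pow_succ', pow_succ]; simp only [mul_assoc])
  have h3 := h1.unique h2
  simp only [Finset.range_one, Finset.sum_singleton, pow_zero, one_mul] at h3
  rw [add_comm]
  exact h3

/-- The function `q (1 - q c)^{-*} * (q - c̄) v`. For `|c| < 1` it is, up to the factor `q`, a
regular Möbius transformation of the unit ball. -/
def extremalFun (c v q : Quaternion ℝ) : Quaternion ℝ :=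
  q * ((q * regGeom c q - regGeom c q * star c) * v)

theorem exists_hasExpansion_extremalFun {c : Quaternion ℝ} (hc : ‖c‖ < 1) (v : Quaternion ℝ) :
    ∃ a, HasExpansion (extremalFun c v) a ∧ a 1 = -(star c * v) :=
  ⟨_, (((hasExpansion_regGeom hc).id_mul.sub
    ((hasExpansion_regGeom hc).mul_const (star c))).mul_const v).id_mul, by simp⟩

theorem regGeom_slicePt {I : Quaternion ℝ} (hI : I ∈ imUnits) {γ z : ℂ} (hγ : ‖γ‖ < 1)
    (hz : ‖z‖ < 1) : regGeom (slicePt I γ) (slicePt I z) = slicePt I (1 - z * γ)⁻¹ := by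
  have h2 := (hasExpansion_regGeom (c := slicePt I γ) (by rwa [norm_slicePt hI]) (slicePt I z)
    (by rwa [mem_B, norm_slicePt hI]))
  have hlt : ‖z * γ‖ < 1 := by
    rw [norm_mul]
    nlinarith [norm_nonneg z, norm_nonneg γ]
  have h3 := hasSum_geometric_of_norm_lt_one hlt
  have hcont : Continuous (sliceHom I hI) :=
    (sliceHom I hI).toLinearMap.continuous_of_finiteDimensional
  have h4 := h3.map (sliceHom I hI) hcont
  simp only [sliceHom_apply] at h4
  refine h2.unique (h4.congr_fun fun n => ?_)
  simp only [Function.comp_apply, sliceHom_apply, mul_pow, slicePt_mul hI, slicePt_pow hI]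

/-- On the slice that contains `c`, the extremal function is a Blaschke product of degree two. -/
theorem extremalFun_slicePt {I : Quaternion ℝ} (hI : I ∈ imUnits) {γ z : ℂ} (hγ : ‖γ‖ < 1)
    (hz : ‖z‖ < 1) (v : Quaternion ℝ) :
    extremalFun (slicePt I γ) v (slicePt I z) =
      slicePt I (z * ((z - starRingEnd ℂ γ) / (1 - z * γ))) * v := by
  rw [extremalFun, regGeom_slicePt hI hγ hz, ← slicePt_conj hI, ← slicePt_mul hI,
    ← slicePt_mul hI, ← slicePt_sub hI, ← mul_assoc, ← slicePt_mul hI]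
  congr 2
  rw [div_eq_mul_inv]
  ring

/-- The coefficients of `u + q v`. -/
def affineCoeff (u v : Quaternion ℝ) : ℕ → Quaternion ℝ
  | 0 => u
  | 1 => v
  | _ + 2 => 0

theorem hasSum_affineCoeff (u v q : Quaternion ℝ) :
    HasSum (fun n => q ^ n * affineCoeff u v n) (u + q * v) := by
  have h : HasSum (fun n => q ^ n * affineCoeff u v n)
      (∑ n ∈ Finset.range 2, q ^ n * affineCoeff u v n) :=
    hasSum_sum_of_ne_finset_zero fun n hn => by
      match n, hn with
      | 0, hn => simp at hn
      | 1, hn => simp at hn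
      | n + 2, _ => simp [affineCoeff]
  simpa [Finset.sum_range_succ, affineCoeff] using h

theorem coeff_affine (u v : Quaternion ℝ) : coeff (fun q => u + q * v) = affineCoeff u v :=
  HasExpansion.coeff_eq fun q _ => hasSum_affineCoeff u v q

theorem regConj_affine (u v : Quaternion ℝ) :
    regConj (fun q => u + q * v) = fun q => star u + q * star v := by
  funext q
  rw [regConj, coeff_affine, ← (hasSum_affineCoeff (star u) (star v) q).tsum_eq]
  refine tsum_congr fun n => ?_
  match n with
  | 0 => simp [affineCoeff]
  | 1 => simp [affineCoeff]
  | n + 2 => simp [affineCoeff]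

theorem symmetrization_affine (u v : Quaternion ℝ) (q : Quaternion ℝ) :
    symmetrization (fun q => u + q * v) q =
      u * star u + q * (u * star v + v * star u) + q ^ 2 * (v * star v) := by
  rw [symmetrization, starMul, regConj_affine, coeff_affine, coeff_affine,
    tsum_eq_sum (s := Finset.range 3)]
  · simp [Finset.sum_range_succ, affineCoeff]
  · intro n hn
    rw [Finset.sum_eq_zero, mul_zero]
    intro k _
    match n, k, hn with
    | 0, _, hn => simp at hn
    | 1, _, hn => simp at hn
    | 2, _, hn => simp at hn
    | n + 3, 0, _ => simp [affineCoeff]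
    | n + 3, 1, _ => simp [affineCoeff]
    | n + 3, k + 2, _ => simp [affineCoeff]

/-- The geometric series `E` satisfies `f^s E = f^c` for `f = 1 - q c`, since the
symmetrization `f^s` has real coefficients. -/
theorem starInv_one_sub {c : Quaternion ℝ} (hc : ‖c‖ < 1) {q : Quaternion ℝ} (hq : q ∈ B 1) :
    starInv (fun p => 1 + p * -c) q = regGeom c q := by
  rw [starInv, symmetrization_affine, regConj_affine]
  have hE := regGeom_eq hc hq
  set E := regGeom c q
  -- The coefficients of the symmetrization are real, so they commute with `E`.
  have ht : c + star c = ((2 * c.re : ℝ) : Quaternion ℝ) := by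
    rw [Quaternion.self_add_star]; push_cast; rfl
  have hn : c * star c = ((Quaternion.normSq c : ℝ) : Quaternion ℝ) := Quaternion.self_mul_star c
  set S : Quaternion ℝ := 1 * star 1 + q * (1 * star (-c) + -c * star 1) + q ^ 2 * (-c * star (-c))
    with hS
  have hS1 : S = 1 - q * (c + star c) + q ^ 2 * (c * star c) := by
    rw [hS]
    simp only [star_one, star_neg, one_mul, mul_one, mul_add, mul_neg, neg_mul,
      neg_neg]
    abel
  have hcE : (c + star c) * E = E * (c + star c) := by
    rw [ht]; exact Quaternion.coe_commutes _ _
  have hnE : (c * star c) * E = E * (c * star c) := by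
    rw [hn]; exact Quaternion.coe_commutes _ _
  have hSE : S * E = 1 - q * star c := by
    have h1 : E - q * E * c = 1 := by
      nth_rewrite 1 [hE]
      abel
    calc S * E = E - q * ((c + star c) * E) + q ^ 2 * ((c * star c) * E) := by
          rw [hS1]; noncomm_ring
      _ = (E - q * E * c) - q * (E - q * E * c) * star c := by
          rw [hcE, hnE]; noncomm_ring
      _ = 1 - q * star c := by rw [h1, mul_one]
  have hS0 : S ≠ 0 := by
    intro h0
    rw [h0, zero_mul] at hSE
    have h1 : ‖q * star c‖ = 1 := by rw [← sub_eq_zero.1 hSE.symm, norm_one]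
    rw [norm_mul, Quaternion.norm_star] at h1
    have := mem_B.1 hq
    nlinarith [norm_nonneg q, norm_nonneg c]
  rw [inv_mul_eq_iff_eq_mul₀ hS0, hSE]
  simp [sub_eq_add_neg]

theorem starMul_starInv_eq {c : Quaternion ℝ} (hc : ‖c‖ < 1) {q : Quaternion ℝ} (hq : q ∈ B 1) :
    starMul (starInv fun p => 1 - p * c) (fun p => p - star c) q =
      q * regGeom c q - regGeom c q * star c := by
  have e1 : (fun p : Quaternion ℝ => 1 - p * c) = fun p => 1 + p * -c := by
    funext p
    rw [mul_neg, sub_eq_add_neg]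
  have e2 : (fun p : Quaternion ℝ => p - star c) = fun p => -star c + p * 1 := by
    funext p
    rw [mul_one, sub_eq_neg_add]
  have h1 : coeff (starInv fun p => 1 + p * -c) = fun n => c ^ n :=
    HasExpansion.coeff_eq fun p hp => by
      rw [starInv_one_sub hc hp]
      exact hasExpansion_regGeom hc p hp
  rw [starMul, e1, e2, h1, coeff_affine]
  have h2 := (hasExpansion_regGeom hc).id_mul.sub
    ((hasExpansion_regGeom hc).mul_const (star c)) q hq
  refine Eq.trans (tsum_congr fun n => ?_) h2.tsum_eq
  congr 1
  match n with
  | 0 => simp [affineCoeff]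
  | n + 1 =>
    rw [Finset.sum_range_succ, Finset.sum_range_succ, Finset.sum_eq_zero]
    · simp [affineCoeff, sub_eq_add_neg]
    · intro k hk
      have hk := Finset.mem_range.1 hk
      obtain ⟨m, hm⟩ : ∃ m, n + 1 - k = m + 2 := ⟨n + 1 - k - 2, by omega⟩
      rw [hm]
      simp [affineCoeff]

theorem exp_smul_unit {I : Quaternion ℝ} (hI : I ∈ imUnits) (θ : ℝ) :
    NormedSpace.exp (θ • I) = slicePt I (Complex.exp (θ * Complex.I)) := by
  have hcont : Continuous (sliceHom I hI) :=
    (sliceHom I hI).toLinearMap.continuous_of_finiteDimensional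
  have h := NormedSpace.map_exp (sliceHom I hI) hcont (θ * Complex.I)
  rw [← Complex.exp_eq_exp_ℂ, sliceHom_apply, sliceHom_apply] at h
  rw [h, slicePt_mul hI, slicePt_ofReal, slicePt_I, Quaternion.coe_mul_eq_smul]

/-- The regular product and reciprocal in the definition of the extremal functions, evaluated. -/
theorem isExtremal_iff {α : ℝ} (hα : α ∈ Ioo (0 : ℝ) 1) (f : Quaternion ℝ → Quaternion ℝ) :
    IsExtremal α f ↔ ∃ I ∈ imUnits, ∃ θ : ℝ, ∃ v : Quaternion ℝ, ‖v‖ = 1 ∧ ∀ q ∈ B 1,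
      f q = extremalFun (slicePt I (α * Complex.exp (-(θ * Complex.I)))) v q := by
  refine exists_congr fun I => and_congr_right fun hI => exists_congr fun θ =>
    exists_congr fun v => and_congr_right fun _ => forall₂_congr fun q hq => ?_
  have e1 : (α : Quaternion ℝ) * NormedSpace.exp (-(θ • I)) =
      slicePt I (α * Complex.exp (-(θ * Complex.I))) := by
    rw [← neg_smul, exp_smul_unit hI, slicePt_mul hI, slicePt_ofReal]
    push_cast
    rw [neg_mul]
  have e2 : (α : Quaternion ℝ) * NormedSpace.exp (θ • I) =
      star (slicePt I (α * Complex.exp (-(θ * Complex.I)))) := by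
    rw [exp_smul_unit hI, ← slicePt_conj hI, map_mul, Complex.conj_ofReal, ← Complex.exp_conj,
      slicePt_mul hI, slicePt_ofReal]
    simp
  have hn : ‖slicePt I (α * Complex.exp (-(θ * Complex.I)))‖ < 1 := by
    rw [norm_slicePt hI, norm_mul, Complex.norm_real, Real.norm_of_nonneg hα.1.le,
      ← neg_mul, ← Complex.ofReal_neg, Complex.norm_exp_ofReal_mul_I, mul_one]
    exact hα.2
  rw [e1, e2, starMul_starInv_eq hn hq, extremalFun, mul_assoc]

/-- Along a suitable radius the extremal function is a rotation of `t ↦ t (α - t) / (1 - α t)`. -/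
theorem IsExtremal.exists_radius {α : ℝ} (hα : α ∈ Ioo (0 : ℝ) 1)
    {f : Quaternion ℝ → Quaternion ℝ} (hf : IsExtremal α f) :
    ∃ e u : Quaternion ℝ, ‖e‖ = 1 ∧ ‖u‖ = 1 ∧ ∀ t : ℝ, 0 ≤ t → t < 1 →
      f (t * e) = coverRadius α t * u := by
  obtain ⟨I, hI, θ, v, hv, hfq⟩ := (isExtremal_iff hα f).1 hf
  have hn : ‖Complex.exp (θ * Complex.I)‖ = 1 := Complex.norm_exp_ofReal_mul_I θ
  have hn' : ‖Complex.exp (-(θ * Complex.I))‖ = 1 := by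
    rw [← neg_mul, ← Complex.ofReal_neg, Complex.norm_exp_ofReal_mul_I]
  have h1 : Complex.exp (θ * Complex.I) * Complex.exp (-(θ * Complex.I)) = 1 := by
    rw [← Complex.exp_add, add_neg_cancel, Complex.exp_zero]
  refine ⟨slicePt I (Complex.exp (θ * Complex.I)),
    -(slicePt I (Complex.exp (θ * Complex.I) ^ 2) * v), by rw [norm_slicePt hI, hn], ?_,
    fun t h0 ht => ?_⟩
  · rw [norm_neg, norm_mul, norm_slicePt hI, norm_pow, hn, hv]; norm_num
  · have hz : (t : Quaternion ℝ) * slicePt I (Complex.exp (θ * Complex.I)) =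
        slicePt I (t * Complex.exp (θ * Complex.I)) := by
      rw [slicePt_mul hI, slicePt_ofReal]
    have hzn : ‖(t : ℂ) * Complex.exp (θ * Complex.I)‖ < 1 := by
      rwa [norm_mul, hn, mul_one, Complex.norm_real, Real.norm_of_nonneg h0]
    rw [hz, hfq _ (by rwa [mem_B, norm_slicePt hI]), extremalFun_slicePt hI ?_ hzn]
    · have e1 : starRingEnd ℂ (α * Complex.exp (-(θ * Complex.I))) =
          α * Complex.exp (θ * Complex.I) := by
        rw [map_mul, Complex.conj_ofReal, ← Complex.exp_conj]
        simp
      have hne : (1 : ℂ) - t * α ≠ 0 := by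
        norm_cast
        nlinarith [hα.1, hα.2]
      have e2 : t * Complex.exp (θ * Complex.I) *
          ((t * Complex.exp (θ * Complex.I) - α * Complex.exp (θ * Complex.I)) /
            (1 - t * Complex.exp (θ * Complex.I) * (α * Complex.exp (-(θ * Complex.I))))) =
          (-coverRadius α t : ℝ) * Complex.exp (θ * Complex.I) ^ 2 := by
        have e3 : t * Complex.exp (θ * Complex.I) * (α * Complex.exp (-(θ * Complex.I))) =
            t * α := by
          linear_combination (t * α : ℂ) * h1
        rw [e3, coverRadius, mul_comm α t]
        push_cast
        field_simp
        ring
      rw [e1, e2, slicePt_mul hI, slicePt_ofReal, Quaternion.coe_neg]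
      noncomm_ring
    · rw [norm_mul, hn', mul_one, Complex.norm_real, Real.norm_of_nonneg hα.1.le]
      exact hα.2

/-! ### The Schwarz–Pick inequality at the origin -/

theorem sub_div_one_sub_le {α x y : ℝ} (hα : α ∈ Ioo (0 : ℝ) 1) (hxy : x ≤ y) (hy : y ≤ 1) :
    (α - y) / (1 - α * y) ≤ (α - x) / (1 - α * x) := by
  have h1 : 0 < 1 - α * y := by nlinarith [hα.1, hα.2]
  have h2 : 0 < 1 - α * x := by nlinarith [hα.1, hα.2]
  rw [div_le_div_iff₀ h1 h2]
  nlinarith [mul_nonneg (sub_nonneg.2 hxy) (show 0 ≤ 1 - α ^ 2 by nlinarith [hα.1, hα.2])]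

theorem sub_div_one_sub_lt {α x y : ℝ} (hα : α ∈ Ioo (0 : ℝ) 1) (hxy : x < y) (hy : y ≤ 1) :
    (α - y) / (1 - α * y) < (α - x) / (1 - α * x) := by
  have h1 : 0 < 1 - α * y := by nlinarith [hα.1, hα.2]
  have h2 : 0 < 1 - α * x := by nlinarith [hα.1, hα.2]
  rw [div_lt_div_iff₀ h1 h2]
  nlinarith [mul_pos (sub_pos.2 hxy) (show 0 < 1 - α ^ 2 by nlinarith [hα.1, hα.2])]

theorem le_norm_moebius {α : ℝ} (hα : α ∈ Ioo (0 : ℝ) 1) {w : ℂ} (hw : ‖w‖ ≤ 1) :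
    (α - ‖w‖) / (1 - α * ‖w‖) ≤ ‖(α - w) / (1 - α * w)‖ := by
  have h1 : 0 < 1 - α * ‖w‖ := by nlinarith [hα.1, hα.2, norm_nonneg w]
  have h2 : 0 < ‖1 - α * w‖ := by
    refine norm_pos_iff.2 fun h => ?_
    have : ‖(α : ℂ) * w‖ = 1 := by rw [← sub_eq_zero.1 h, norm_one]
    rw [norm_mul, Complex.norm_real, Real.norm_of_nonneg hα.1.le] at this
    linarith
  rw [norm_div, div_le_div_iff₀ h1 h2]
  rcases le_total α ‖w‖ with h | h
  · exact (mul_nonpos_of_nonpos_of_nonneg (by linarith) h2.le).trans (by positivity)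
  refine abs_le_of_sq_le_sq' ?_ (by positivity) |>.2
  have e0 : w.re ^ 2 + w.im ^ 2 = ‖w‖ ^ 2 := by
    rw [← Complex.normSq_eq_norm_sq, Complex.normSq_apply]; ring
  have e1 : ‖1 - α * w‖ ^ 2 = 1 - 2 * α * w.re + α ^ 2 * ‖w‖ ^ 2 := by
    rw [← e0, ← Complex.normSq_eq_norm_sq]; simp [Complex.normSq_apply]; ring
  have e2 : ‖α - w‖ ^ 2 = α ^ 2 - 2 * α * w.re + ‖w‖ ^ 2 := by
    rw [← e0, ← Complex.normSq_eq_norm_sq]; simp [Complex.normSq_apply]; ring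
  rw [mul_pow, mul_pow, e1, e2]
  have h3 := Complex.re_le_norm w
  have h4 : 0 ≤ 2 * α * (‖w‖ - w.re) * ((1 - α ^ 2) * (1 - ‖w‖ ^ 2)) := by
    have h5 : 0 ≤ 1 - α ^ 2 := by nlinarith [hα.1, hα.2]
    have h6 : 0 ≤ 1 - ‖w‖ ^ 2 := by nlinarith [norm_nonneg w]
    have := hα.1
    have : 0 ≤ ‖w‖ - w.re := by linarith
    positivity
  nlinarith

/-- The Schwarz–Pick inequality at the origin for scalar functions, with its case of equality. -/
theorem schwarzPick_complex {α : ℝ} (hα : α ∈ Ioo (0 : ℝ) 1) {φ : ℂ → ℂ}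
    (hd : DifferentiableOn ℂ φ (ball 0 1)) (hle : ∀ z : ℂ, ‖z‖ < 1 → ‖φ z‖ ≤ 1) (h0 : φ 0 = α) :
    (∀ z : ℂ, ‖z‖ < 1 → (α - ‖z‖) / (1 - α * ‖z‖) ≤ ‖φ z‖) ∧
    ∀ z₀ : ℂ, z₀ ≠ 0 → ‖z₀‖ < 1 → ‖φ z₀‖ ≤ (α - ‖z₀‖) / (1 - α * ‖z₀‖) →
      ∃ η : ℂ, ‖η‖ = 1 ∧ ∀ z : ℂ, ‖z‖ < 1 → φ z = (α - η * z) / (1 - α * (η * z)) := by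
  have hden : ∀ w : ℂ, ‖w‖ ≤ 1 → 1 - (α : ℂ) * w ≠ 0 := fun w hw h => by
    have : ‖(α : ℂ) * w‖ = 1 := by rw [← sub_eq_zero.1 h, norm_one]
    rw [norm_mul, Complex.norm_real, Real.norm_of_nonneg hα.1.le] at this
    nlinarith [hα.1, hα.2]
  set ψ : ℂ → ℂ := fun z => (α - φ z) / (1 - α * φ z) with hψ
  have hψd : DifferentiableOn ℂ ψ (ball 0 1) :=
    (hd.const_sub _).div ((hd.const_mul _).const_sub _) fun z hz =>
      hden _ (hle z (mem_ball_zero_iff.1 hz))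
  have hψ1 : ∀ z : ℂ, ‖z‖ < 1 → ‖ψ z‖ ≤ 1 := by
    intro z hz
    have h1 := hle z hz
    rw [hψ]
    simp only
    rw [norm_div, div_le_one (norm_pos_iff.2 (hden _ h1)),
      ← sq_le_sq₀ (norm_nonneg _) (norm_nonneg _), ← Complex.normSq_eq_norm_sq,
      ← Complex.normSq_eq_norm_sq]
    have e0 : (φ z).re ^ 2 + (φ z).im ^ 2 ≤ 1 := by
      have : ‖φ z‖ ^ 2 ≤ 1 := pow_le_one₀ (norm_nonneg _) h1
      rw [← Complex.normSq_eq_norm_sq, Complex.normSq_apply] at this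
      linarith
    simp only [Complex.normSq_apply, Complex.sub_re, Complex.sub_im, Complex.ofReal_re,
      Complex.ofReal_im, Complex.one_re, Complex.one_im, Complex.re_ofReal_mul,
      Complex.im_ofReal_mul]
    nlinarith [hα.1, hα.2, mul_nonneg (show 0 ≤ 1 - α ^ 2 by nlinarith [hα.1, hα.2])
      (sub_nonneg.2 e0)]
  have hψ0 : ψ 0 = 0 := by simp [hψ, h0]
  have hφ : ∀ z : ℂ, ‖z‖ < 1 → φ z = (α - ψ z) / (1 - α * ψ z) := by
    intro z hz
    have h1 := hden _ (hle z hz)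
    have h2 := hden _ (hψ1 z hz)
    have h3 : ψ z * (1 - α * φ z) = α - φ z := div_mul_cancel₀ _ h1
    rw [eq_div_iff h2]
    linear_combination h3
  have hmaps : MapsTo ψ (ball 0 1) (closedBall 0 1) := fun z hz =>
    mem_closedBall_zero_iff.2 (hψ1 z (mem_ball_zero_iff.1 hz))
  have hschwarz : ∀ z : ℂ, ‖z‖ < 1 → ‖ψ z‖ ≤ ‖z‖ := fun z hz =>
    Complex.norm_le_norm_of_mapsTo_ball hψd hmaps hψ0 hz
  refine ⟨fun z hz => ?_, fun z₀ hz0 hz1 heq => ?_⟩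
  · rw [hφ z hz]
    exact (sub_div_one_sub_le hα (hschwarz z hz) hz.le).trans (le_norm_moebius hα (hψ1 z hz))
  · have h1 : ‖ψ z₀‖ = ‖z₀‖ := by
      refine (hschwarz z₀ hz1).antisymm (not_lt.1 fun hlt => ?_)
      have h2 := le_norm_moebius hα (hψ1 z₀ hz1)
      rw [← hφ z₀ hz1] at h2
      exact absurd (h2.trans heq) (not_le.2 (sub_div_one_sub_lt hα hlt hz1.le))
    have h2 : dslope ψ 0 z₀ = ψ z₀ / z₀ := by
      rw [dslope_of_ne _ hz0, slope_def_field, hψ0, sub_zero, sub_zero]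
    have h3 : ‖dslope ψ 0 z₀‖ = 1 := by
      rw [h2, norm_div, h1, div_self (norm_ne_zero_iff.2 hz0)]
    refine ⟨dslope ψ 0 z₀, h3, fun z hz => ?_⟩
    have h4 := Complex.affine_of_mapsTo_ball_of_norm_dslope_eq_div hψd
      (by rwa [hψ0]) (mem_ball_zero_iff.2 hz1) (by rw [h3, div_one]) (mem_ball_zero_iff.2 hz)
    simp only [hψ0, sub_zero, zero_add, smul_eq_mul] at h4
    rw [hφ z hz, h4, mul_comm z]

theorem inner_unit_mul {I : Quaternion ℝ} (hI : I ∈ imUnits) (p q : Quaternion ℝ) :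
    ⟪p, I * q⟫ = -⟪I * p, q⟫ := by
  have h0 := re_of_mem_imUnits hI
  simp [Quaternion.inner_def, h0]
  ring

/-- The coordinate along the unit quaternion `u` for the complex structure `ℂ_I`. -/
def sliceCoord (I u p : Quaternion ℝ) : ℂ := ⟨⟪u, p⟫, ⟪I * u, p⟫⟩

theorem sliceCoord_mul {I : Quaternion ℝ} (hI : I ∈ imUnits) (u p : Quaternion ℝ) (z : ℂ) :
    sliceCoord I u (slicePt I z * p) = z * sliceCoord I u p := by
  have h1 : slicePt I z * p = z.re • p + z.im • (I * p) := by
    rw [slicePt, add_mul, mul_assoc, Quaternion.coe_mul_eq_smul, Quaternion.coe_mul_eq_smul]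
  have h2 : ⟪I * u, I * p⟫ = ⟪u, p⟫ := by
    rw [inner_unit_mul hI, ← mul_assoc, mul_self_of_mem_imUnits hI, neg_one_mul, inner_neg_left,
      neg_neg]
  rw [h1]
  apply Complex.ext
  · simp only [sliceCoord, inner_add_right, inner_smul_right, Complex.mul_re, inner_unit_mul hI]
    ring
  · simp only [sliceCoord, inner_add_right, inner_smul_right, Complex.mul_im, h2]

theorem norm_sub_sliceCoord_sq {I : Quaternion ℝ} (hI : I ∈ imUnits) {u : Quaternion ℝ}
    (hu : ‖u‖ = 1) (p : Quaternion ℝ) :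
    ‖p - slicePt I (sliceCoord I u p) * u‖ ^ 2 = ‖p‖ ^ 2 - ‖sliceCoord I u p‖ ^ 2 := by
  have h1 : slicePt I (sliceCoord I u p) * u = ⟪u, p⟫ • u + ⟪I * u, p⟫ • (I * u) := by
    rw [slicePt, add_mul, mul_assoc, Quaternion.coe_mul_eq_smul, Quaternion.coe_mul_eq_smul]
    rfl
  rw [norm_sub_sq_real, norm_mul, norm_slicePt hI, hu, mul_one, h1, inner_add_right,
    inner_smul_right, inner_smul_right, real_inner_comm u p, real_inner_comm (I * u) p,
    ← Complex.normSq_eq_norm_sq, Complex.normSq_apply, sliceCoord]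
  ring

theorem norm_sliceCoord_le {I : Quaternion ℝ} (hI : I ∈ imUnits) {u : Quaternion ℝ}
    (hu : ‖u‖ = 1) (p : Quaternion ℝ) : ‖sliceCoord I u p‖ ≤ ‖p‖ := by
  have h := norm_sub_sliceCoord_sq hI hu p
  refine abs_le_of_sq_le_sq' ?_ (norm_nonneg _) |>.2
  nlinarith [sq_nonneg ‖p - slicePt I (sliceCoord I u p) * u‖]

/-- The coordinate `sliceCoord` as a continuous linear map over `ℂ ≅ ℂ_I`. -/
def sliceCoordL (I : Quaternion ℝ) (hI : I ∈ imUnits) (u : Quaternion ℝ) (hu : ‖u‖ = 1) :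
    letI := sliceSpace I hI
    Quaternion ℝ →L[ℂ] ℂ :=
  letI := sliceSpace I hI
  LinearMap.mkContinuous
    { toFun := sliceCoord I u
      map_add' := fun p q => by
        apply Complex.ext <;> simp [sliceCoord, inner_add_right]
      map_smul' := fun z p => by
        change sliceCoord I u (sliceHom I hI z * p) = z * _
        rw [sliceHom_apply, sliceCoord_mul hI] }
    1 fun p => by
      rw [one_mul]
      exact norm_sliceCoord_le hI hu p

theorem HasExpansion.differentiableOn_slice {f : Quaternion ℝ → Quaternion ℝ}
    {a : ℕ → Quaternion ℝ} (h : HasExpansion f a) {I : Quaternion ℝ} (hI : I ∈ imUnits) :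
    letI := sliceSpace I hI
    DifferentiableOn ℂ (fun z => f (slicePt I z)) (ball 0 1) := by
  let := sliceSpace I hI
  have h1 : DifferentiableOn ℂ (fun z : ℂ => ∑' n, z ^ n • a n) (ball 0 1) := by
    intro z hz
    obtain ⟨ρ, hρ, hρ1⟩ := exists_between (mem_ball_zero_iff.1 hz)
    have h2 : DifferentiableOn ℂ (fun z : ℂ => ∑' n, z ^ n • a n) (ball 0 ρ) := by
      refine Complex.differentiableOn_tsum_of_summable_norm
        (h.convergesOnBall ρ ((norm_nonneg _).trans hρ.le) hρ1) (fun n => by fun_prop)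
        isOpen_ball fun n w hw => ?_
      rw [norm_smul, norm_pow, mul_comm]
      have := (mem_ball_zero_iff.1 hw).le
      gcongr
    exact (h2.differentiableAt
      (isOpen_ball.mem_nhds (mem_ball_zero_iff.2 hρ))).differentiableWithinAt
  refine h1.congr fun z hz => ?_
  rw [mem_ball_zero_iff] at hz
  rw [← (h (slicePt I z) (by rwa [mem_B, norm_slicePt hI])).tsum_eq]
  refine tsum_congr fun n => ?_
  change _ = sliceHom I hI (z ^ n) * a n
  rw [map_pow, sliceHom_apply]

/-- The Schwarz–Pick inequality at the origin for regular maps into the closed unit ball. When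
equality holds at some point `x + y I`, the restriction to the slice of `I` is a scalar Möbius
transformation times a constant. -/
theorem schwarzPick {g : Quaternion ℝ → Quaternion ℝ} {b : ℕ → Quaternion ℝ}
    (hg : HasExpansion g b) (hle : ∀ q ∈ B 1, ‖g q‖ ≤ 1) {α : ℝ} (hα : α ∈ Ioo (0 : ℝ) 1)
    (h0 : ‖g 0‖ = α) {I : Quaternion ℝ} (hI : I ∈ imUnits) :
    (∀ z : ℂ, ‖z‖ < 1 → (α - ‖z‖) / (1 - α * ‖z‖) ≤ ‖g (slicePt I z)‖) ∧
    ∀ z₀ : ℂ, z₀ ≠ 0 → ‖z₀‖ < 1 → ‖g (slicePt I z₀)‖ ≤ (α - ‖z₀‖) / (1 - α * ‖z₀‖) →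
      ∃ η : ℂ, ‖η‖ = 1 ∧ ∃ u : Quaternion ℝ, ‖u‖ = 1 ∧ ∀ z : ℂ, ‖z‖ < 1 →
        g (slicePt I z) = slicePt I ((α - η * z) / (1 - α * (η * z))) * u := by
  let := sliceSpace I hI
  set u : Quaternion ℝ := α⁻¹ • g 0 with hu'
  have hα0 := hα.1
  have hu : ‖u‖ = 1 := by
    rw [hu', norm_smul, h0, norm_inv, Real.norm_of_nonneg hα0.le, inv_mul_cancel₀ hα0.ne']
  have hg0 : g 0 = α • u := by
    rw [hu', smul_smul, mul_inv_cancel₀ hα0.ne', one_smul]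
  set φ : ℂ → ℂ := fun z => sliceCoord I u (g (slicePt I z)) with hφ
  have hgd := hg.differentiableOn_slice hI
  have hφd : DifferentiableOn ℂ φ (ball 0 1) :=
    (sliceCoordL I hI u hu).differentiable.comp_differentiableOn hgd
  have hφ0 : φ 0 = α := by
    have h1 : ⟪I * u, u⟫ = 0 := by
      have := inner_unit_mul hI u u
      rw [real_inner_comm] at this
      linarith
    simp only [hφ, slicePt_zero, hg0, sliceCoord, inner_smul_right, h1, real_inner_self_eq_norm_sq,
      hu]
    apply Complex.ext <;> simp
  have hg1 : ∀ z : ℂ, ‖z‖ < 1 → ‖g (slicePt I z)‖ ≤ 1 := fun z hz =>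
    hle _ (by rwa [mem_B, norm_slicePt hI])
  have hφg : ∀ z, ‖φ z‖ ≤ ‖g (slicePt I z)‖ := fun z => norm_sliceCoord_le hI hu _
  obtain ⟨h1, h2⟩ := schwarzPick_complex hα hφd (fun z hz => (hφg z).trans (hg1 z hz)) hφ0
  refine ⟨fun z hz => (h1 z hz).trans (hφg z), fun z₀ hz0 hz1 heq => ?_⟩
  obtain ⟨η, hη, hφη⟩ := h2 z₀ hz0 hz1 ((hφg z₀).trans heq)
  refine ⟨η, hη, u, hu, fun z hz => ?_⟩
  -- The component of `g` orthogonal to `ℂ_I u` tends to zero at the boundary, hence vanishes.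
  set h : ℂ → Quaternion ℝ := fun z => g (slicePt I z) - φ z • u with hh
  have hhd : DifferentiableOn ℂ h (ball 0 1) := hgd.sub (hφd.smul_const u)
  have hsm : ∀ z, h z = g (slicePt I z) - slicePt I (φ z) * u := fun z => by
    rw [← sliceHom_apply hI (φ z)]
    rfl
  have hbd : ∀ z : ℂ, ‖z‖ < 1 → ‖h z‖ ≤ √((1 - ‖z‖ ^ 2) / (1 - α) ^ 2) := by
    intro z hz
    apply Real.le_sqrt_of_sq_le
    rw [hsm z]
    refine (norm_sub_sliceCoord_sq hI hu _).trans_le ?_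
    have h3 : ‖g (slicePt I z)‖ ^ 2 ≤ 1 := pow_le_one₀ (norm_nonneg _) (hg1 z hz)
    have h4 : 1 - α ≤ ‖1 - α * (η * z)‖ := by
      have h5 := norm_sub_norm_le (1 : ℂ) (α * (η * z))
      rw [norm_one, norm_mul, norm_mul, hη, Complex.norm_real, Real.norm_of_nonneg hα0.le] at h5
      nlinarith
    have h5 : 0 < 1 - α := by linarith [hα.2]
    have h6 : 1 - ‖φ z‖ ^ 2 ≤ (1 - ‖z‖ ^ 2) / (1 - α) ^ 2 := by
      rw [hφη z hz, norm_div, div_pow, one_sub_div (pow_pos (h5.trans_le h4) 2).ne']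
      have e : ‖1 - α * (η * z)‖ ^ 2 - ‖α - η * z‖ ^ 2 = (1 - α ^ 2) * (1 - ‖z‖ ^ 2) := by
        have e0 : (η * z).re ^ 2 + (η * z).im ^ 2 = ‖z‖ ^ 2 := by
          have : ‖η * z‖ ^ 2 = ‖z‖ ^ 2 := by rw [norm_mul, hη, one_mul]
          rw [← this, ← Complex.normSq_eq_norm_sq, Complex.normSq_apply]; ring
        rw [← e0, ← Complex.normSq_eq_norm_sq, ← Complex.normSq_eq_norm_sq]
        simp only [Complex.normSq_apply, Complex.sub_re, Complex.sub_im, Complex.ofReal_re,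
          Complex.ofReal_im, Complex.one_re, Complex.one_im, Complex.re_ofReal_mul,
          Complex.im_ofReal_mul]
        ring
      rw [e]
      have h7 : 0 ≤ 1 - ‖z‖ ^ 2 := by nlinarith [norm_nonneg z]
      refine div_le_div₀ h7 ?_ (by positivity) (by gcongr)
      nlinarith
    linarith
  have hz0 : h z = 0 := by
    have hlim : Tendsto (fun ρ : ℝ => √((1 - ρ ^ 2) / (1 - α) ^ 2)) (𝓝[<] 1) (𝓝 0) := by
      have hcont : Continuous fun ρ : ℝ => √((1 - ρ ^ 2) / (1 - α) ^ 2) := by fun_prop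
      have := (hcont.tendsto 1).mono_left (nhdsWithin_le_nhds (s := Iio 1))
      simpa using this
    refine norm_le_zero_iff.1 (ge_of_tendsto hlim ?_)
    filter_upwards [Ioo_mem_nhdsLT (max_lt one_pos hz)] with ρ hρ
    obtain ⟨hρ0, hρz⟩ := max_lt_iff.1 hρ.1
    refine Complex.norm_le_of_forall_mem_frontier_norm_le (U := ball 0 ρ) isBounded_ball
      (hhd.diffContOnCl_ball (closedBall_subset_ball hρ.2)) (fun w hw => ?_)
      (subset_closure (mem_ball_zero_iff.2 hρz))
    rw [frontier_ball _ hρ0.ne', mem_sphere_zero_iff_norm] at hw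
    rw [← hw]
    exact hbd w (hw ▸ hρ.2)
  rw [← hφη z hz]
  exact sub_eq_zero.1 ((hsm z).symm.trans hz0)

/-! ### The family of regular self-maps with prescribed derivative at the origin -/

/-- A member `f` of the family factors as `f(q) = q g(q)`, where `g` is regular with values in the
closed unit ball (by the Schwarz lemma on slices). -/
theorem exists_factor {α : ℝ} (hα : α ∈ Ioo (0 : ℝ) 1) {f : Quaternion ℝ → Quaternion ℝ}
    (hf : f ∈ family α) :
    ∃ a b g, HasExpansion f a ∧ a 0 = 0 ∧ HasExpansion g b ∧ (∀ q ∈ B 1, f q = q * g q) ∧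
      (∀ q ∈ B 1, ‖g q‖ ≤ 1) ∧ ‖g 0‖ = α := by
  obtain ⟨hmaps, hreg, hf0, hf1⟩ := hf
  obtain ⟨a, ha, ha1⟩ := hreg.exists_hasExpansion
  have h0 : a 0 = 0 := by
    have h1 := ha.eq_stem unitI_mem (z := 0) (by simp)
    rw [slicePt_zero, stemRe_zero, stemIm_zero, mul_zero, add_zero, hf0] at h1
    exact h1.symm
  have hb : ConvergesOnBall fun n => a (n + 1) := by
    intro ρ hρ0 hρ1
    rcases hρ0.eq_or_lt with rfl | hρ
    · exact summable_of_ne_finset_zero (s := {0}) fun n hn => by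
        rw [Finset.mem_singleton] at hn
        simp [hn]
    · refine (((summable_nat_add_iff 1).2 (ha.convergesOnBall ρ hρ0 hρ1)).mul_left ρ⁻¹).congr
        fun n => ?_
      rw [pow_succ]
      field_simp
  have hg := hb.hasExpansion
  set g : Quaternion ℝ → Quaternion ℝ := fun q => ∑' n, q ^ n * a (n + 1) with hgdef
  have hfg : ∀ q ∈ B 1, f q = q * g q := by
    intro q hq
    have h1 := (hasSum_nat_add_iff (f := fun n => q ^ n * a n) 1).1
      (((hg q hq).mul_left q).congr_fun fun n => by rw [pow_succ', mul_assoc])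
    have h2 := (ha q hq).unique h1
    simpa [h0] using h2
  have hg0 : g 0 = a 1 := by
    have h1 := hg.eq_stem unitI_mem (z := 0) (by simp)
    rwa [slicePt_zero, stemRe_zero, stemIm_zero, mul_zero, add_zero] at h1
  have hg0' : ‖g 0‖ = α := by rw [hg0, ← ha1, hf1]
  refine ⟨a, _, g, ha, h0, hg, hfg, fun q hq => ?_, hg0'⟩
  by_cases hq0 : q = 0
  · rw [hq0, hg0']
    exact hα.2.le
  · obtain ⟨I, hI, z, rfl⟩ := exists_slicePt q
    let := sliceSpace I hI
    have hz : ‖z‖ < 1 := by rwa [mem_B, norm_slicePt hI] at hq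
    have h1 := Complex.norm_le_norm_of_mapsTo_ball (ha.differentiableOn_slice hI)
      (fun w hw => ?_) (by rw [slicePt_zero, hf0]) hz
    · rw [hfg _ hq, norm_mul, norm_slicePt hI] at h1
      have h2 : 0 < ‖z‖ := by
        rw [← norm_slicePt hI]
        exact norm_pos_iff.2 hq0
      exact le_of_mul_le_mul_left (by rwa [mul_one]) h2
    · have h2 := hmaps (show slicePt I w ∈ B 1 by
        rw [mem_B, norm_slicePt hI]; exact mem_ball_zero_iff.1 hw)
      exact mem_closedBall_zero_iff.2 (mem_B.1 h2).le

theorem le_norm_factor {α : ℝ} (hα : α ∈ Ioo (0 : ℝ) 1) {g : Quaternion ℝ → Quaternion ℝ}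
    {b : ℕ → Quaternion ℝ} (hg : HasExpansion g b) (hle : ∀ q ∈ B 1, ‖g q‖ ≤ 1) (h0 : ‖g 0‖ = α)
    {q : Quaternion ℝ} (hq : ‖q‖ < 1) : (α - ‖q‖) / (1 - α * ‖q‖) ≤ ‖g q‖ := by
  obtain ⟨I, hI, z, rfl⟩ := exists_slicePt q
  rw [norm_slicePt hI] at hq ⊢
  exact (schwarzPick hg hle hα h0 hI).1 z hq

/-- Equality in the Schwarz–Pick inequality at a nonzero point characterises the extremal
functions. -/
theorem isExtremal_of_norm_le {α : ℝ} (hα : α ∈ Ioo (0 : ℝ) 1) {f g : Quaternion ℝ → Quaternion ℝ}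
    {a b : ℕ → Quaternion ℝ} (hf : HasExpansion f a) (hg : HasExpansion g b)
    (hfg : ∀ q ∈ B 1, f q = q * g q) (hle : ∀ q ∈ B 1, ‖g q‖ ≤ 1) (h0 : ‖g 0‖ = α)
    {q : Quaternion ℝ} (hq0 : q ≠ 0) (hq : ‖q‖ < 1)
    (heq : ‖g q‖ ≤ (α - ‖q‖) / (1 - α * ‖q‖)) : IsExtremal α f := by
  obtain ⟨I, hI, z, rfl⟩ := exists_slicePt q
  rw [norm_slicePt hI] at hq heq
  have hz0 : z ≠ 0 := by
    rintro rfl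
    exact hq0 (slicePt_zero I)
  obtain ⟨η, hη, u, hu, hgu⟩ := (schwarzPick hg hle hα h0 hI).2 z hz0 hq heq
  refine (isExtremal_iff hα f).2 ⟨I, hI, -η.arg, -(slicePt I η * u), ?_, ?_⟩
  · rw [norm_neg, norm_mul, norm_slicePt hI, hη, hu, one_mul]
  · have e1 : Complex.exp (-(((-η.arg : ℝ) : ℂ) * Complex.I)) = η := by
      have h1 := Complex.norm_mul_exp_arg_mul_I η
      rw [hη, Complex.ofReal_one, one_mul] at h1
      rw [Complex.ofReal_neg, neg_mul, neg_neg, h1]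
    rw [e1]
    have hn : ‖(α : ℂ) * η‖ < 1 := by
      rw [norm_mul, hη, mul_one, Complex.norm_real, Real.norm_of_nonneg hα.1.le]
      exact hα.2
    obtain ⟨c, hc, -⟩ := exists_hasExpansion_extremalFun (c := slicePt I (α * η))
      (by rwa [norm_slicePt hI]) (-(slicePt I η * u))
    refine hf.eqOn_of_real hc fun x hx => ?_
    have hx1 : ‖(x : ℂ)‖ < 1 := by rwa [Complex.norm_real]
    have hxB : (x : Quaternion ℝ) ∈ B 1 := by rwa [mem_B, Quaternion.norm_coe]
    have h1 := hgu x hx1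
    rw [slicePt_ofReal] at h1
    have h2 := extremalFun_slicePt hI hn hx1 (-(slicePt I η * u))
    rw [slicePt_ofReal] at h2
    have h3 : starRingEnd ℂ η * η = 1 := by
      rw [← Complex.normSq_eq_conj_mul_self, Complex.normSq_eq_norm_sq, hη]; simp
    have e2 : (x : ℂ) * ((α - η * x) / (1 - α * (η * x))) =
        -((x * ((x - starRingEnd ℂ (α * η)) / (1 - x * (α * η)))) * η) := by
      rw [show (1 : ℂ) - x * (α * η) = 1 - α * (η * x) by ring, map_mul, Complex.conj_ofReal,
        ← mul_div_assoc, ← mul_div_assoc, div_mul_eq_mul_div, ← neg_div]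
      congr 1
      linear_combination -(x * α : ℂ) * h3
    rw [h2, hfg _ hxB, h1, ← mul_assoc, ← slicePt_ofReal I, ← slicePt_mul hI, e2,
      ← sliceHom_apply hI (-_), map_neg, sliceHom_apply, slicePt_mul hI _ η]
    noncomm_ring

/-- The extremal functions with `θ = 0` belong to the family. -/
theorem extremalFun_mem_family {α : ℝ} (hα : α ∈ Ioo (0 : ℝ) 1) {v : Quaternion ℝ} (hv : ‖v‖ = 1) :
    extremalFun α v ∈ family α := by
  have hn : ‖(α : ℂ)‖ < 1 := by
    rw [Complex.norm_real, Real.norm_of_nonneg hα.1.le]; exact hα.2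
  set ϕ : ℂ → ℂ := fun z => z * ((z - starRingEnd ℂ α) / (1 - z * α)) with hϕ
  have hden : ∀ z : ℂ, ‖z‖ < 1 → 1 - z * (α : ℂ) ≠ 0 := fun z hz h => by
    have : ‖z * (α : ℂ)‖ = 1 := by rw [← sub_eq_zero.1 h, norm_one]
    rw [norm_mul] at this
    nlinarith [norm_nonneg z, norm_nonneg (α : ℂ)]
  have hval : ∀ I ∈ imUnits, ∀ z : ℂ, ‖z‖ < 1 →
      extremalFun α v (slicePt I z) = slicePt I (ϕ z) * v := fun I hI z hz => by
    rw [← extremalFun_slicePt hI hn hz, slicePt_ofReal]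
  have hϕd : DifferentiableOn ℂ ϕ (ball 0 1) :=
    differentiableOn_id.mul ((differentiableOn_id.sub_const _).div
      ((differentiableOn_id.mul_const _).const_sub _) fun z hz => hden z (mem_ball_zero_iff.1 hz))
  have hreg : IsSliceRegularOn (extremalFun α v) (B 1) := by
    intro I hI
    rw [preimage_slicePt_B hI]
    set T : ℂ →L[ℝ] Quaternion ℝ := LinearMap.toContinuousLinearMap
      ((LinearMap.mulRight ℝ v).comp (sliceHom I hI).toLinearMap) with hT
    have hTv : ∀ z, T z = slicePt I z * v := fun z => by
      rw [← sliceHom_apply hI]; rfl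
    have hcongr : ∀ z ∈ ball (0 : ℂ) 1, extremalFun α v (slicePt I z) = T (ϕ z) := fun z hz => by
      rw [hTv, hval I hI z (mem_ball_zero_iff.1 hz)]
    constructor
    · refine ContDiffOn.congr ?_ hcongr
      exact T.contDiff.comp_contDiffOn ((hϕd.contDiffOn isOpen_ball).restrict_scalars ℝ)
    · intro z hz
      have h1 : HasFDerivAt (fun w : ℂ => extremalFun α v (slicePt I w))
          (T.comp ((fderiv ℂ ϕ z).restrictScalars ℝ)) z := by
        refine HasFDerivAt.congr_of_eventuallyEq ?_
          (Filter.eventuallyEq_of_mem (isOpen_ball.mem_nhds hz) hcongr)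
        exact T.hasFDerivAt.comp z
          ((hϕd.differentiableAt (isOpen_ball.mem_nhds hz)).hasFDerivAt.restrictScalars ℝ)
      have h2 : fderiv ℂ ϕ z Complex.I = Complex.I * fderiv ℂ ϕ z 1 := by
        rw [← smul_eq_mul, ← map_smul, smul_eq_mul, mul_one]
      rw [partialX, partialY, h1.fderiv]
      simp only [ContinuousLinearMap.comp_apply, ContinuousLinearMap.coe_restrictScalars', h2, hTv,
        slicePt_mul hI, slicePt_I]
      rw [← mul_assoc, ← mul_assoc, mul_self_of_mem_imUnits hI, neg_one_mul, neg_mul,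
        add_neg_cancel, smul_zero]
  have hϕ1 : ∀ z : ℂ, ‖z‖ < 1 → ‖ϕ z‖ < 1 := by
    intro z hz
    refine lt_of_le_of_lt ?_ hz
    rw [hϕ]
    simp only
    rw [norm_mul, norm_div]
    refine mul_le_of_le_one_right (norm_nonneg _) ?_
    rw [div_le_one (norm_pos_iff.2 (hden z hz)), ← sq_le_sq₀ (norm_nonneg _) (norm_nonneg _),
      ← Complex.normSq_eq_norm_sq, ← Complex.normSq_eq_norm_sq]
    have e0 : z.re ^ 2 + z.im ^ 2 ≤ 1 := by
      have : ‖z‖ ^ 2 ≤ 1 := pow_le_one₀ (norm_nonneg _) hz.le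
      rw [← Complex.normSq_eq_norm_sq, Complex.normSq_apply] at this
      linarith
    simp only [Complex.normSq_apply, Complex.sub_re, Complex.sub_im, Complex.ofReal_re,
      Complex.ofReal_im, Complex.one_re, Complex.one_im, Complex.re_mul_ofReal,
      Complex.im_mul_ofReal, Complex.conj_ofReal]
    nlinarith [mul_nonneg (show 0 ≤ 1 - α ^ 2 by nlinarith [hα.1, hα.2]) (sub_nonneg.2 e0)]
  refine ⟨fun q hq => ?_, hreg, ?_, ?_⟩
  · obtain ⟨I, hI, z, rfl⟩ := exists_slicePt q
    rw [mem_B, norm_slicePt hI] at hq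
    rw [mem_B, hval I hI z hq, norm_mul, norm_slicePt hI, hv, mul_one]
    exact hϕ1 z hq
  · rw [extremalFun, zero_mul]
  · have hnα : ‖(α : Quaternion ℝ)‖ = α := by
      rw [Quaternion.norm_coe, Real.norm_of_nonneg hα.1.le]
    obtain ⟨a, ha, ha1⟩ := exists_hasExpansion_extremalFun (c := (α : Quaternion ℝ))
      (by rw [hnα]; exact hα.2) v
    obtain ⟨a', ha', h1⟩ := hreg.exists_hasExpansion
    rw [h1, ha'.unique ha, ha1, norm_neg, norm_mul, hv, mul_one, Quaternion.norm_star, hnα]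

theorem isExtremal_extremalFun {α : ℝ} (hα : α ∈ Ioo (0 : ℝ) 1) {v : Quaternion ℝ} (hv : ‖v‖ = 1) :
    IsExtremal α (extremalFun α v) := by
  refine (isExtremal_iff hα _).2 ⟨unitI, unitI_mem, 0, v, hv, fun q _ => ?_⟩
  rw [Complex.ofReal_zero, zero_mul, neg_zero, Complex.exp_zero, mul_one, slicePt_ofReal]

/-! ### The radius of injectivity -/

theorem radius_spec {α : ℝ} (hα : α ∈ Ioo (0 : ℝ) 1) :
    0 < α / (1 + √(1 - α ^ 2)) ∧ α / (1 + √(1 - α ^ 2)) < α ∧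
      (α - α / (1 + √(1 - α ^ 2))) / (1 - α * (α / (1 + √(1 - α ^ 2)))) =
        α / (1 + √(1 - α ^ 2)) := by
  obtain ⟨h0, h1⟩ := hα
  have h2 : 0 < 1 - α ^ 2 := by nlinarith
  have h3 : 0 < √(1 - α ^ 2) := Real.sqrt_pos.2 h2
  have h4 : √(1 - α ^ 2) ^ 2 = 1 - α ^ 2 := Real.sq_sqrt h2.le
  generalize √(1 - α ^ 2) = s at *
  have h5 : α / (1 + s) < α := div_lt_self h0 (by linarith)
  refine ⟨by positivity, h5, ?_⟩
  have h6 : 0 < 1 - α * (α / (1 + s)) := by nlinarith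
  rw [div_eq_iff h6.ne']
  field_simp
  nlinarith

/-- If `f(q) = q g(q)` is a regular self-map of the unit ball and `|g| ≥ r` on the ball of radius
`r`, then `f` is injective there. -/
theorem injOn_of_le_norm_factor {f g : Quaternion ℝ → Quaternion ℝ} {a : ℕ → Quaternion ℝ}
    (hf : HasExpansion f a) (h0 : a 0 = 0) (hmaps : MapsTo f (B 1) (B 1))
    (hfg : ∀ q ∈ B 1, f q = q * g q) {r : ℝ} (hr : r ≤ 1)
    (hg : ∀ q, ‖q‖ < r → r ≤ ‖g q‖) : InjOn f (B r) := by
  have key : ∀ p q : Quaternion ℝ, ‖p‖ < r → ‖q‖ < r → p ≠ 0 → f p = f q → p = q := by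
    intro p q hp hq hp0 hpq
    by_contra hne
    have h1 := norm_le_mul_of_eq hf h0 hmaps (hp.trans_le hr) (hq.trans_le hr) hne hpq
    rw [hfg p (mem_B.2 (hp.trans_le hr)), norm_mul] at h1
    have h2 := le_of_mul_le_mul_left h1 (norm_pos_iff.2 hp0)
    linarith [hg p hp]
  intro p hp q hq hpq
  rw [mem_B] at hp hq
  by_cases hp0 : p = 0
  · by_cases hq0 : q = 0
    · rw [hp0, hq0]
    · exact (key q p hq hp hq0 hpq.symm).symm
  · exact key p q hp hq hp0 hpq

theorem le_injRadius {f : Quaternion ℝ → Quaternion ℝ} {r : ℝ} (h0 : 0 < r) (h1 : r ≤ 1)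
    (h : InjOn f (B r)) : r ≤ injRadius f :=
  le_csSup ⟨1, fun _ hs => hs.2.1⟩ ⟨h0, h1, h⟩

theorem injOn_of_mem_family {α : ℝ} (hα : α ∈ Ioo (0 : ℝ) 1) {f : Quaternion ℝ → Quaternion ℝ}
    (hf : f ∈ family α) : InjOn f (B (α / (1 + √(1 - α ^ 2)))) := by
  obtain ⟨a, b, g, ha, ha0, hg, hfg, hle, hg0⟩ := exists_factor hα hf
  obtain ⟨h1, h2, h3⟩ := radius_spec hα
  have h4 : α / (1 + √(1 - α ^ 2)) < 1 := h2.trans hα.2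
  refine injOn_of_le_norm_factor ha ha0 hf.1 hfg h4.le fun q hq => ?_
  refine le_trans ?_ (le_norm_factor hα hg hle hg0 (hq.trans h4))
  conv_lhs => rw [← h3]
  exact sub_div_one_sub_le hα hq.le h4.le

theorem injRadius_le_of_isExtremal {α : ℝ} (hα : α ∈ Ioo (0 : ℝ) 1)
    {f : Quaternion ℝ → Quaternion ℝ} (hf : f ∈ family α) (he : IsExtremal α f) :
    injRadius f ≤ α / (1 + √(1 - α ^ 2)) := by
  obtain ⟨h1, h2, h3⟩ := radius_spec hα
  have hinj := injOn_of_mem_family hα hf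
  refine csSup_le ⟨_, h1, (h2.trans hα.2).le, hinj⟩ ?_
  rintro s ⟨hs0, hs1, hs⟩
  by_contra! hlt
  set ρ := α / (1 + √(1 - α ^ 2))
  obtain ⟨e, u, he1, hu, hfe⟩ := he.exists_radius hα
  obtain ⟨t, ht, htm⟩ := exists_between (lt_min hlt h2)
  obtain ⟨hts, htα⟩ := lt_min_iff.1 htm
  -- The involution `t ↦ (α - t) / (1 - α t)` preserves `coverRadius α` and fixes only `ρ`.
  have ht' : (α - t) / (1 - α * t) < ρ := by
    conv_rhs => rw [← h3]
    exact sub_div_one_sub_lt hα ht (htα.trans hα.2).le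
  have hd : 0 < 1 - α * t := by nlinarith [hα.1, hα.2]
  have ht0 : 0 ≤ (α - t) / (1 - α * t) := div_nonneg (by linarith) hd.le
  have hR : coverRadius α ((α - t) / (1 - α * t)) = coverRadius α t := by
    have h5 : (1 - α * ((α - t) / (1 - α * t))) = (1 - α ^ 2) / (1 - α * t) := by
      rw [eq_div_iff hd.ne']
      field_simp
      ring
    have h6 : (1 - α ^ 2) ≠ 0 := by nlinarith [hα.1, hα.2]
    rw [coverRadius, coverRadius, h5]
    field_simp
    ring
  have hB : ∀ x : ℝ, 0 ≤ x → x < s → (x : Quaternion ℝ) * e ∈ B s := fun x hx0 hxs => by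
    rwa [mem_B, norm_mul, he1, mul_one, Quaternion.norm_coe, Real.norm_of_nonneg hx0]
  have h7 := hs (hB _ ht0 (ht'.trans hlt)) (hB t (h1.trans ht).le hts) (by
    rw [hfe _ ht0 (by linarith), hfe t (h1.trans ht).le (by linarith), hR])
  have he0 : e ≠ 0 := by
    rintro rfl
    simp at he1
  have h8 := Quaternion.coe_injective (mul_right_cancel₀ he0 h7)
  linarith

theorem isExtremal_of_injRadius_eq {α : ℝ} (hα : α ∈ Ioo (0 : ℝ) 1)
    {f : Quaternion ℝ → Quaternion ℝ} (hf : f ∈ family α)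
    (h : injRadius f = α / (1 + √(1 - α ^ 2))) : IsExtremal α f := by
  by_contra hne
  obtain ⟨a, b, g, ha, ha0, hg, hfg, hle, hg0⟩ := exists_factor hα hf
  obtain ⟨h1, h2, h3⟩ := radius_spec hα
  set ρ := α / (1 + √(1 - α ^ 2))
  have hρ1 : ρ < 1 := h2.trans hα.2
  have hlt : ∀ q ∈ closedBall (0 : Quaternion ℝ) ρ, ρ < ‖g q‖ := by
    intro q hq
    rw [mem_closedBall_zero_iff] at hq
    by_cases hq0 : q = 0
    · rw [hq0, hg0]
      exact h2
    · have h4 : (α - ‖q‖) / (1 - α * ‖q‖) < ‖g q‖ := not_le.1 fun h5 =>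
        hne (isExtremal_of_norm_le hα ha hg hfg hle hg0 hq0 (hq.trans_lt hρ1) h5)
      refine lt_of_le_of_lt ?_ h4
      conv_lhs => rw [← h3]
      exact sub_div_one_sub_le hα hq hρ1.le
  have hsub : closedBall (0 : Quaternion ℝ) ρ ⊆ B 1 := closedBall_subset_ball hρ1
  obtain ⟨q₀, hq₀, hmin⟩ := (isCompact_closedBall (0 : Quaternion ℝ) ρ).exists_isMinOn
    (nonempty_closedBall.2 h1.le) (hg.continuousOn.norm.mono hsub)
  obtain ⟨m, hm, hm'⟩ := exists_between (hlt q₀ hq₀)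
  have hopen : IsOpen (B 1 ∩ (fun q => ‖g q‖) ⁻¹' Ioi m) :=
    hg.continuousOn.norm.isOpen_inter_preimage isOpen_ball isOpen_Ioi
  obtain ⟨δ, hδ, hδs⟩ := (isCompact_closedBall (0 : Quaternion ℝ) ρ).exists_thickening_subset_open
    hopen fun q hq => ⟨hsub hq, hm'.trans_le (hmin hq)⟩
  rw [thickening_closedBall hδ h1.le] at hδs
  have hr : ρ < min (δ + ρ) m := lt_min (by linarith) hm
  have hr1 : min (δ + ρ) m ≤ 1 :=
    (min_le_right _ _).trans (hm'.le.trans (hle _ (hsub hq₀)))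
  have h5 := le_injRadius (h1.trans hr) hr1 (injOn_of_le_norm_factor ha ha0 hf.1 hfg hr1
    fun q hq => (min_le_right _ _).trans
      (hδs (mem_ball_zero_iff.2 (hq.trans_le (min_le_left _ _)))).2.le)
  linarith

theorem familyRadius_eq {α : ℝ} (hα : α ∈ Ioo (0 : ℝ) 1) :
    familyRadius α = α / (1 + √(1 - α ^ 2)) := by
  obtain ⟨h1, h2, -⟩ := radius_spec hα
  have hle : ∀ f ∈ family α, α / (1 + √(1 - α ^ 2)) ≤ injRadius f := fun f hf =>
    le_injRadius h1 (h2.trans hα.2).le (injOn_of_mem_family hα hf)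
  have hmem := extremalFun_mem_family hα (v := 1) norm_one
  refine IsLeast.csInf_eq ⟨⟨_, hmem, ?_⟩, ?_⟩
  · exact (injRadius_le_of_isExtremal hα hmem (isExtremal_extremalFun hα norm_one)).antisymm
      (hle _ hmem)
  · rintro _ ⟨f, hf, rfl⟩
    exact hle f hf

/-! ### The covered ball -/

theorem coverRadius_lt {α x r : ℝ} (hα : α ∈ Ioo (0 : ℝ) 1) (hxr : x < r)
    (hr : r ≤ α / (1 + √(1 - α ^ 2))) : coverRadius α x < coverRadius α r := by
  obtain ⟨h1, h2, h3⟩ := radius_spec hα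
  generalize α / (1 + √(1 - α ^ 2)) = ρ at *
  obtain ⟨hα0, hα1⟩ := hα
  have hρ : 0 < 1 - α * ρ := by nlinarith
  rw [div_eq_iff hρ.ne'] at h3
  have hdr : 0 < 1 - α * r := by nlinarith
  have hdx : 0 < 1 - α * x := by nlinarith
  have h4 : 0 ≤ (ρ - r) * (2 - α * (r + ρ)) :=
    mul_nonneg (sub_nonneg.2 hr) (by nlinarith)
  have h5 : 0 < (r - x) * ((ρ - r) * (2 - α * (r + ρ)) + (r - x) * (1 - α * r)) :=
    mul_pos (sub_pos.2 hxr) (by nlinarith [mul_pos (sub_pos.2 hxr) hdr])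
  rw [coverRadius, coverRadius, ← mul_div_assoc, ← mul_div_assoc, div_lt_div_iff₀ hdx hdr]
  linear_combination h5 - (r - x) * h3

theorem coverRadius_le_norm {α : ℝ} (hα : α ∈ Ioo (0 : ℝ) 1) {f g : Quaternion ℝ → Quaternion ℝ}
    {b : ℕ → Quaternion ℝ} (hg : HasExpansion g b) (hfg : ∀ q ∈ B 1, f q = q * g q)
    (hle : ∀ q ∈ B 1, ‖g q‖ ≤ 1) (h0 : ‖g 0‖ = α) {q : Quaternion ℝ} (hq : ‖q‖ < 1) :
    coverRadius α ‖q‖ ≤ ‖f q‖ := by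
  rw [hfg q (mem_B.2 hq), norm_mul, coverRadius]
  exact mul_le_mul_of_nonneg_left (le_norm_factor hα hg hle h0 hq) (norm_nonneg _)

theorem B_coverRadius_subset {α : ℝ} (hα : α ∈ Ioo (0 : ℝ) 1) {f : Quaternion ℝ → Quaternion ℝ}
    (hf : f ∈ family α) {r : ℝ} (hr0 : 0 < r) (hr1 : r < 1) :
    B (coverRadius α r) ⊆ f '' B r := by
  obtain ⟨a, b, g, ha, ha0, hg, hfg, hle, hg0⟩ := exists_factor hα hf
  refine B_subset_image ha ha0 hr0 hr1 fun q hq => ?_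
  rw [← hq]
  exact coverRadius_le_norm hα hg hfg hle hg0 (hq ▸ hr1)

/-- A value omitted on the ball of radius `r` by an extremal function with `θ = 0`: the equation
`f(q) = -s v` reduces to a quadratic equation with real coefficients. -/
theorem neg_smul_notMem_image {α : ℝ} (hα : α ∈ Ioo (0 : ℝ) 1) {r : ℝ}
    (hr0 : 0 < r) (hr : r ≤ α / (1 + √(1 - α ^ 2))) {v : Quaternion ℝ} (hv : ‖v‖ = 1) {s : ℝ}
    (hs : coverRadius α r ≤ s) : -(s • v) ∉ extremalFun α v '' B r := by
  rintro ⟨q, hq, hqs⟩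
  obtain ⟨I, hI, z, rfl⟩ := exists_slicePt q
  rw [mem_B, norm_slicePt hI] at hq
  obtain ⟨h1, h2, h3⟩ := radius_spec hα
  have hr1 : r < 1 := hr.trans_lt (h2.trans hα.2)
  have hsq : r ^ 2 ≤ coverRadius α r := by
    rw [coverRadius, sq]
    refine mul_le_mul_of_nonneg_left (hr.trans ?_) hr0.le
    conv_lhs => rw [← h3]
    exact sub_div_one_sub_le hα hr (h2.trans hα.2).le
  have hn : ‖(α : ℂ)‖ < 1 := by
    rw [Complex.norm_real, Real.norm_of_nonneg hα.1.le]; exact hα.2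
  have hv0 : v ≠ 0 := by
    rintro rfl
    simp at hv
  have hden : 1 - z * (α : ℂ) ≠ 0 := fun h => by
    have : ‖z * (α : ℂ)‖ = 1 := by rw [← sub_eq_zero.1 h, norm_one]
    rw [norm_mul] at this
    nlinarith [norm_nonneg z, norm_nonneg (α : ℂ)]
  have heq : z * (z - α) = -s * (1 - z * α) := by
    rw [← slicePt_ofReal I, extremalFun_slicePt hI hn (hq.trans hr1), Complex.conj_ofReal,
      ← Quaternion.coe_mul_eq_smul, ← neg_mul, ← slicePt_ofReal I] at hqs
    have h4 := mul_right_cancel₀ hv0 hqs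
    rw [← sub_eq_zero, sub_neg_eq_add, ← slicePt_add hI, ← norm_eq_zero, norm_slicePt hI,
      norm_eq_zero, ← mul_div_assoc] at h4
    exact (div_eq_iff hden).1 (eq_neg_of_add_eq_zero_left h4)
  have hre := congrArg Complex.re heq
  have him := congrArg Complex.im heq
  simp only [Complex.mul_re, Complex.mul_im, Complex.sub_re, Complex.sub_im, Complex.ofReal_re,
    Complex.ofReal_im, Complex.neg_re, Complex.neg_im, Complex.one_re, Complex.one_im] at hre him
  have hnz : z.re ^ 2 + z.im ^ 2 < r ^ 2 := by
    have : ‖z‖ ^ 2 < r ^ 2 := pow_lt_pow_left₀ hq (norm_nonneg _) two_ne_zero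
    rw [← Complex.normSq_eq_norm_sq, Complex.normSq_apply] at this
    linarith
  -- Non-real roots come in a conjugate pair with product `s`.
  rcases mul_eq_zero.1 (show z.im * (2 * z.re - α * (1 + s)) = 0 by linarith) with hy | hx
  · have hxr : z.re < r := (Complex.re_le_norm z).trans_lt hq
    have h4 := coverRadius_lt hα hxr hr
    have h5 : 0 < 1 - α * z.re := by nlinarith [hα.1, hα.2]
    rw [hy] at hre
    have h6 : coverRadius α z.re = s := by
      rw [coverRadius, ← mul_div_assoc, div_eq_iff h5.ne']
      linarith
    linarith
  · have hy : z.re ^ 2 + z.im ^ 2 = s := by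
      linear_combination z.re * hx - hre
    linarith

theorem iInter_image_eq {α : ℝ} (hα : α ∈ Ioo (0 : ℝ) 1) {r : ℝ} (hr0 : 0 < r)
    (hr : r ≤ α / (1 + √(1 - α ^ 2))) :
    (⋂ f ∈ family α, f '' B r) = B (coverRadius α r) := by
  obtain ⟨h1, h2, -⟩ := radius_spec hα
  apply Subset.antisymm
  · intro w hw
    rw [mem_B]
    by_contra! hlt
    have hpos : 0 < coverRadius α r := by
      have := coverRadius_lt hα hr0 hr
      rwa [coverRadius, zero_mul] at this
    have hw0 : 0 < ‖w‖ := hpos.trans_le hlt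
    have hv : ‖-(‖w‖⁻¹ • w)‖ = 1 := by
      rw [norm_neg, norm_smul, norm_inv, norm_norm, inv_mul_cancel₀ hw0.ne']
    refine neg_smul_notMem_image hα hr0 hr hv hlt ?_
    rw [smul_neg, neg_neg, smul_smul, mul_inv_cancel₀ hw0.ne', one_smul]
    exact mem_iInter₂.1 hw _ (extremalFun_mem_family hα hv)
  · exact subset_iInter₂ fun f hf =>
      B_coverRadius_subset hα hf hr0 (hr.trans_lt (h2.trans hα.2))

theorem isGreatest_iff {α : ℝ} (hα : α ∈ Ioo (0 : ℝ) 1) {f : Quaternion ℝ → Quaternion ℝ}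
    (hf : f ∈ family α) {r : ℝ} (hr0 : 0 < r) (hr : r < α / (1 + √(1 - α ^ 2))) :
    IsGreatest {ρ : ℝ | B ρ ⊆ f '' B r} (coverRadius α r) ↔ IsExtremal α f := by
  obtain ⟨h1, h2, -⟩ := radius_spec hα
  have hr1 : r < 1 := hr.trans (h2.trans hα.2)
  constructor
  · intro hgr
    by_contra hne
    obtain ⟨a, b, g, ha, ha0, hg, hfg, hle, hg0⟩ := exists_factor hα hf
    have hsub : sphere (0 : Quaternion ℝ) r ⊆ B 1 := sphere_subset_ball hr1
    obtain ⟨q₀, hq₀, hmin⟩ := (isCompact_sphere (0 : Quaternion ℝ) r).exists_isMinOn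
      ⟨(r : Quaternion ℝ), by simp [hr0.le]⟩ (ha.continuousOn.norm.mono hsub)
    have h3 : B ‖f q₀‖ ⊆ f '' B r := B_subset_image ha ha0 hr0 hr1 fun q hq =>
      hmin (mem_sphere_zero_iff_norm.2 hq)
    have h4 := hgr.2 h3
    rw [mem_sphere_zero_iff_norm] at hq₀
    rw [hfg q₀ (mem_B.2 (hq₀ ▸ hr1)), norm_mul, hq₀, coverRadius] at h4
    have h5 := le_of_mul_le_mul_left h4 hr0
    refine hne (isExtremal_of_norm_le hα ha hg hfg hle hg0 (norm_pos_iff.1 (hq₀ ▸ hr0))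
      (hq₀ ▸ hr1) ?_)
    rwa [hq₀]
  · intro he
    refine ⟨B_coverRadius_subset hα hf hr0 hr1, fun ρ hρ => ?_⟩
    by_contra! hlt
    obtain ⟨e, u, he1, hu, hfe⟩ := he.exists_radius hα
    have hpos : 0 < coverRadius α r := by
      have := coverRadius_lt hα hr0 hr.le
      rwa [coverRadius, zero_mul] at this
    have hn : ‖(r : Quaternion ℝ) * e‖ = r := by
      rw [norm_mul, he1, mul_one, Quaternion.norm_coe, Real.norm_of_nonneg hr0.le]
    obtain ⟨q, hq, hqe⟩ := hρ (show f (r * e) ∈ B ρ by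
      rwa [hfe r hr0.le hr1, mem_B, norm_mul, hu, mul_one, Quaternion.norm_coe,
        Real.norm_of_nonneg hpos.le])
    rw [mem_B] at hq
    have h3 := injOn_of_mem_family hα hf (mem_B.2 (hq.trans hr)) (mem_B.2 (hn.symm ▸ hr)) hqe
    rw [h3, hn] at hq
    exact lt_irrefl _ hq

end SliceRegular

end

theorem theorem1p4 (α : ℝ) (hα : α ∈ Set.Ioo (0 : ℝ) 1) :
    SliceRegular.familyRadius α = α / (1 + Real.sqrt (1 - α ^ 2)) ∧
    (∀ f ∈ SliceRegular.family α,
      SliceRegular.familyRadius α ≤ SliceRegular.injRadius f ∧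
      (SliceRegular.injRadius f = SliceRegular.familyRadius α ↔ SliceRegular.IsExtremal α f)) ∧
    (∀ r : ℝ, 0 < r → r ≤ SliceRegular.familyRadius α →
      (⋂ f ∈ SliceRegular.family α, f '' SliceRegular.B r) =
        SliceRegular.B (SliceRegular.coverRadius α r)) ∧
    (∀ r : ℝ, 0 < r → r < SliceRegular.familyRadius α → ∀ f ∈ SliceRegular.family α,
      SliceRegular.B (SliceRegular.coverRadius α r) ⊆ f '' SliceRegular.B r ∧
      (IsGreatest {ρ : ℝ | SliceRegular.B ρ ⊆ f '' SliceRegular.B r}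
          (SliceRegular.coverRadius α r) ↔ SliceRegular.IsExtremal α f)) := by
  obtain ⟨h1, h2, -⟩ := SliceRegular.radius_spec hα
  have hα1 := h2.trans hα.2
  rw [SliceRegular.familyRadius_eq hα]
  have hle : ∀ f ∈ SliceRegular.family α, α / (1 + √(1 - α ^ 2)) ≤ SliceRegular.injRadius f :=
    fun f hf => SliceRegular.le_injRadius h1 hα1.le (SliceRegular.injOn_of_mem_family hα hf)
  refine ⟨rfl, fun f hf => ⟨hle f hf, SliceRegular.isExtremal_of_injRadius_eq hα hf, fun he =>
    (SliceRegular.injRadius_le_of_isExtremal hα hf he).antisymm (hle f hf)⟩,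
    fun r hr0 hr => SliceRegular.iInter_image_eq hα hr0 hr, fun r hr0 hr f hf =>
    ⟨SliceRegular.B_coverRadius_subset hα hf hr0 (hr.trans hα1),
      SliceRegular.isGreatest_iff hα hf hr0 hr⟩⟩
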